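/- Let $\Omega\subset(\mathbb R\setminus\{0\})^d$ be open and non-empty. All products $xy=(x_1y_1,\dots,x_dy_d)$ and reciprocals $1/x=(1/x_1,\dots,1/x_d)$ are taken coordinatewise. A *Hadamard operator* on $\mathcal D'(\Omega)$ is a continuous linear operator $L:\mathcal D'(\Omega)\to\mathcal D'(\Omega)$ such that for every $\alpha\in\mathbb N_0^d$ the monomial $\xi^\alpha$, regarded as the distribution $\varphi\mapsto\int\xi^\alpha\varphi(\xi)\,d\xi$, is an eigenvector of $L$. Put $$V_*(\Omega)=\{\eta\in(\mathbb R\setminus\{0\})^d:\ \eta\,\Omega\subset\Omega\},\qquad 1/M=\{1/x:\ x\in M\}\quad\text{for } M\subset(\mathbb R\setminus\{0\})^d .$$ For $S\in\mathcal D'(\Omega)$ and $T\in\mathcal D'((\mathbb R\setminus\{0\})^d)$ the multiplicative convolution is $$(S\star T)\varphi=S_y\bigl(T_x\,\varphi(xy)\bigr),$$ which makes sense for $\varphi\in\mathcal D(\Omega)$ if the function $y\mapsto T_x\varphi(xy)$ belongs to $\mathcal D(\Omega)$. Let $\mathcal E'((\mathbb R\setminus\{0\})^d)$ be the space of distributions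 on $(\mathbb R\setminus\{0\})^d$ whose support is a compact subset of $(\mathbb R\setminus\{0\})^d$. **Theorem.** If $T\in\mathcal E'((\mathbb R\setminus\{0\})^d)$ and $1/\operatorname{supp}T\subset V_*(\Omega)$, then for every $S\in\mathcal D'(\Omega)$ the formula for $S\star T$ makes sense for all $\varphi\in\mathcal D(\Omega)$ and defines a distribution $S\star T\in\mathcal D'(\Omega)$. A map $L:\mathcal D'(\Omega)\to\mathcal D'(\Omega)$ is a Hadamard operator if and only if there is a distribution $T\in\mathcal E'((\mathbb R\setminus\{0\})^d)$ with $1/\operatorname{supp}T\subset V_*(\Omega)$ such that $L(S)=S\star T$ for all $S\in\mathcal D'(\Omega)$. (This holds for real-valued as well as for complex-valued distributions.) -/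

import Mathlib

open TopologicalSpace MeasureTheory
open scoped Distributions CompactConvergenceCLM

noncomputable section

/-- The open set `(ℝ ∖ {0})^d` of all points of `ℝ^d` none of whose coordinates vanishes.
The space `ℝ^d` is `Fin d → ℝ`; its product `x * y`, its inverse `x⁻¹` and its unit `1` are
the coordinatewise ones. -/
def nonzeroCoords (d : ℕ) : Opens (Fin d → ℝ) where
  carrier := {x | ∀ j, x j ≠ 0}
  is_open' := by
    simp only [Set.ofPred_forall]
    exact isOpen_iInter_of_finite fun j => isOpen_ne_fun (continuous_apply j) continuous_const

/-- `𝓓'(Ω)`: the continuous `𝕜`-linear functionals on the space of `𝕜`-valued test functions on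
`Ω` (with its canonical LF topology). The space carries the topology of uniform convergence on
compact sets of test functions; this is the strong dual topology, because the space of test
functions is a Montel space. For `𝕜 = ℝ` this is Mathlib's `Distribution Ω ℝ ⊤`. -/
abbrev ScalarDistribution (𝕜 : Type*) [RCLike 𝕜] {d : ℕ} (Ω : Opens (Fin d → ℝ)) :=
  𝓓(Ω, 𝕜) →L_c[𝕜] 𝕜

/-- The monomial `ξ ^ α`, regarded as a distribution on `Ω`: `φ ↦ ∫ φ(ξ) ξ ^ α dξ`, with the
Lebesgue integral. -/
def monomialDistribution (𝕜 : Type*) [RCLike 𝕜] {d : ℕ} (Ω : Opens (Fin d → ℝ))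
    (α : Fin d → ℕ) : ScalarDistribution 𝕜 Ω :=
  (TestFunction.integralAgainstBilinCLM (ContinuousLinearMap.mul 𝕜 𝕜) volume
    (fun ξ : Fin d → ℝ => ((∏ j, ξ j ^ α j : ℝ) : 𝕜)) : 𝓓(Ω, 𝕜) →L[𝕜] 𝕜)

/-- The integral in `monomialDistribution` is never a junk value: monomials are locally
integrable. -/
theorem monomialDistribution_apply (𝕜 : Type*) [RCLike 𝕜] {d : ℕ} (Ω : Opens (Fin d → ℝ))
    (α : Fin d → ℕ) (φ : 𝓓(Ω, 𝕜)) :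
    monomialDistribution 𝕜 Ω α φ = ∫ ξ : Fin d → ℝ, φ ξ * ((∏ j, ξ j ^ α j : ℝ) : 𝕜) := by
  have h : LocallyIntegrableOn (fun ξ : Fin d → ℝ => ((∏ j, ξ j ^ α j : ℝ) : 𝕜)) Ω volume := by
    refine (Continuous.locallyIntegrable ?_).locallyIntegrableOn _
    exact RCLike.continuous_ofReal.comp
      (continuous_finsetProd _ fun j _ => (continuous_apply j).pow _)
  exact TestFunction.integralAgainstBilinCLM_eq_integral h

/-- A Hadamard operator on `𝓓'(Ω)` is a continuous linear map of `𝓓'(Ω)` into itself which has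
every monomial as an eigenvector. -/
def IsHadamardOperator {𝕜 : Type*} [RCLike 𝕜] {d : ℕ} {Ω : Opens (Fin d → ℝ)}
    (L : ScalarDistribution 𝕜 Ω → ScalarDistribution 𝕜 Ω) : Prop :=
  ∃ A : ScalarDistribution 𝕜 Ω →L[𝕜] ScalarDistribution 𝕜 Ω, ⇑A = L ∧
    ∀ α : Fin d → ℕ, ∃ m : 𝕜,
      Module.End.HasEigenvector (A : ScalarDistribution 𝕜 Ω →ₗ[𝕜] ScalarDistribution 𝕜 Ω) m
        (monomialDistribution 𝕜 Ω α)

/-- The support of a distribution on `Ω`, as a subset of `Ω`: the points of `Ω` near which the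
distribution does not vanish. -/
def supportIn {𝕜 : Type*} [RCLike 𝕜] {d : ℕ} {Ω : Opens (Fin d → ℝ)}
    (T : ScalarDistribution 𝕜 Ω) : Set (Fin d → ℝ) :=
  Distribution.dsupport T ∩ (Ω : Set (Fin d → ℝ))

/-- `V_*(M)`: the `η` with nonzero coordinates such that `η M ⊆ M`. -/
def dilationSet {d : ℕ} (M : Set (Fin d → ℝ)) : Set (Fin d → ℝ) :=
  {η | η ∈ nonzeroCoords d ∧ ∀ x ∈ M, η * x ∈ M}

/-- For a test function `φ` on `Ω ⊆ (ℝ ∖ {0})^d` and `y ∈ (ℝ ∖ {0})^d`, the test function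
`x ↦ φ (x y)` on `(ℝ ∖ {0})^d`. -/
def dilateTestFunction {𝕜 : Type*} [RCLike 𝕜] {d : ℕ} {Ω : Opens (Fin d → ℝ)}
    (hΩ : Ω ≤ nonzeroCoords d) (φ : 𝓓(Ω, 𝕜)) (y : Fin d → ℝ) (hy : y ∈ nonzeroCoords d) :
    𝓓(nonzeroCoords d, 𝕜) :=
  let e : (Fin d → ℝ) ≃ₜ (Fin d → ℝ) :=
    Homeomorph.piCongrRight fun j => Homeomorph.mulRight₀ (y j) (hy j)
  have hts : tsupport (fun x => φ (x * y)) = e ⁻¹' tsupport φ :=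
    tsupport_comp_eq_preimage (φ : (Fin d → ℝ) → 𝕜) e
  { toFun := fun x => φ (x * y)
    contDiff' := φ.contDiff.comp (contDiff_id.mul contDiff_const)
    hasCompactSupport' := φ.hasCompactSupport.comp_homeomorph e
    tsupport_subset' := by
      rw [hts]
      intro x hx j hxj
      refine hΩ (φ.tsupport_subset hx) j ?_
      change x j * y j = 0
      rw [hxj, zero_mul] }

/-- `IsMulConv hΩ S T R` says that the multiplicative convolution `S ⋆ T`, given by
`(S ⋆ T) φ = S_y (T_x φ(x y))`, makes sense for all test functions `φ` on `Ω` and is the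
distribution `R`. That it makes sense for `φ` means that the function `y ↦ T_x φ(x y)` is a test
function `ψ` on `Ω`, so that `S` can be applied to it. -/
def IsMulConv {𝕜 : Type*} [RCLike 𝕜] {d : ℕ} {Ω : Opens (Fin d → ℝ)}
    (hΩ : Ω ≤ nonzeroCoords d) (S : ScalarDistribution 𝕜 Ω)
    (T : ScalarDistribution 𝕜 (nonzeroCoords d)) (R : ScalarDistribution 𝕜 Ω) : Prop :=
  ∀ φ : 𝓓(Ω, 𝕜), ∃ ψ : 𝓓(Ω, 𝕜),
    (∀ (y : Fin d → ℝ) (hy : y ∈ nonzeroCoords d), ψ y = T (dilateTestFunction hΩ φ y hy)) ∧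
      R φ = S ψ

/-- The compactly supported distributions `T` on `(ℝ ∖ {0})^d` with `1 / supp T ⊆ V_*(Ω)`. -/
def IsHadamardSymbol {𝕜 : Type*} [RCLike 𝕜] {d : ℕ} (Ω : Opens (Fin d → ℝ))
    (T : ScalarDistribution 𝕜 (nonzeroCoords d)) : Prop :=
  IsCompact (supportIn T) ∧ (fun x => x⁻¹) '' supportIn T ⊆ dilationSet (Ω : Set (Fin d → ℝ))

end

/-!
The space `𝓓(Ω)` of test functions is a Montel space, so every continuous linear functional on
`𝓓'(Ω)` is evaluation at a test function, and a continuous linear operator `L` on `𝓓'(Ω)` is the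
transpose of a linear map `M` of `𝓓(Ω)`. That `L` multiplies `ξ ^ α` by `m α` means
`∫ ξ ^ α (M φ)(ξ) dξ = m α ∫ ξ ^ α φ(ξ) dξ`. By Weierstrass' theorem a test function is determined
by its moments, and the moments of a dilated function are multiples of those of the function;
therefore `M` commutes with dilations. Formally `T f = (M (f (· / y))) y` then does not depend
on `y`. A partition of unity makes this a distribution `T` on all of `(ℝ ∖ {0})^d`, and
`(M φ) y = T_x φ(x y)` says `L S = S ⋆ T`.

Conversely, if `1 / supp T ⊆ V_*(Ω)` and `χ` is a cutoff function equal to `1` near `supp T`, the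
map `φ ↦ (y ↦ T_x (χ(x) φ(x y)))` is continuous on `𝓓(Ω)`. Its transpose is `S ↦ S ⋆ T`, and the
change of variables `ξ = x y` in the moments gives the eigenvalues
`T (χ(x) |∏ j, x j|⁻¹ x ^ (-α))`.
-/

noncomputable section

open Filter Topology
open scoped ContDiff Manifold Pointwise

section Montel

variable {E F : Type*} [NormedAddCommGroup E] [NormedSpace ℝ E]
  [NormedAddCommGroup F] [NormedSpace ℝ F] {K : Compacts E} {B : ℕ → ℝ}

/-- The smooth functions supported in `K` whose `i`-th derivative is bounded by `B i` for every
`i`: the model of a bounded set of test functions. -/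
def derivBoundedSet (F : Type*) [NormedAddCommGroup F] [NormedSpace ℝ F] (K : Compacts E)
    (B : ℕ → ℝ) : Set 𝓓_{K}(E, F) :=
  {f | ∀ i x, ‖iteratedFDeriv ℝ i f x‖ ≤ B i}

theorem lipschitzWith_iteratedFDeriv_of_mem_derivBoundedSet {f : 𝓓_{K}(E, F)}
    (hf : f ∈ derivBoundedSet F K B) (i : ℕ) :
    LipschitzWith (B (i + 1)).toNNReal (iteratedFDeriv ℝ i f) := by
  refine lipschitzWith_of_nnnorm_fderiv_le (𝕜 := ℝ)
    (f.contDiff.differentiable_iteratedFDeriv (mod_cast ENat.natCast_lt_top i)) fun x => ?_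
  rw [← NNReal.coe_le_coe, coe_nnnorm, norm_fderiv_iteratedFDeriv]
  exact (hf (i + 1) x).trans (Real.le_coe_toNNReal _)

theorem exists_tendsto_iteratedFDeriv [FiniteDimensional ℝ E] [FiniteDimensional ℝ F]
    (U : Ultrafilter (derivBoundedSet F K B)) :
    ∃ p : E → FormalMultilinearSeries ℝ E F, ∀ x i,
      Tendsto (fun f : derivBoundedSet F K B => iteratedFDeriv ℝ i f.1 x) U (𝓝 (p x i)) := by
  suffices h : ∀ x i, ∃ v : E [×i]→L[ℝ] F,
      Tendsto (fun f : derivBoundedSet F K B => iteratedFDeriv ℝ i f.1 x) U (𝓝 v) by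
    choose p hp using h
    exact ⟨p, hp⟩
  intro x i
  have : FiniteDimensional ℝ (E [×i]→L[ℝ] F) :=
    FiniteDimensional.of_injective
      (ContinuousMultilinearMap.toMultilinearMapLinear (R' := ℝ) (A := ℝ))
      ContinuousMultilinearMap.toMultilinearMap_injective
  have : ProperSpace (E [×i]→L[ℝ] F) := FiniteDimensional.proper ℝ _
  obtain ⟨v, -, hv⟩ := (isCompact_closedBall (0 : E [×i]→L[ℝ] F) (B i)).ultrafilter_le_nhds
    (U.map fun f : derivBoundedSet F K B => iteratedFDeriv ℝ i f.1 x)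
    (le_principal_iff.2 <| Filter.mem_map.2 <| Filter.univ_mem' fun f => by simpa using f.2 i x)
  exact ⟨v, hv⟩

section Limit

variable {l : Filter (derivBoundedSet F K B)} [l.NeBot] {p : E → FormalMultilinearSeries ℝ E F}

theorem eq_zero_of_tendsto_iteratedFDeriv {x : E} {i : ℕ} {v : E [×i]→L[ℝ] F}
    (hv : Tendsto (fun f : derivBoundedSet F K B => iteratedFDeriv ℝ i f.1 x) l (𝓝 v))
    (hx : x ∉ K) : v = 0 :=
  tendsto_nhds_unique hv <| tendsto_const_nhds.congr fun f =>
    (f.1.iteratedFDeriv_zero_on_compl hx).symm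

theorem tendstoUniformly_iteratedFDeriv
    (hp : ∀ x i, Tendsto (fun f : derivBoundedSet F K B => iteratedFDeriv ℝ i f.1 x) l
      (𝓝 (p x i))) (i : ℕ) :
    TendstoUniformly (fun (f : derivBoundedSet F K B) x => iteratedFDeriv ℝ i f.1 x)
      (fun x => p x i) l := by
  have hequi : UniformEquicontinuous
      (fun (f : derivBoundedSet F K B) x => iteratedFDeriv ℝ i f.1 x) :=
    LipschitzWith.uniformEquicontinuous _ _ fun f =>
      lipschitzWith_iteratedFDeriv_of_mem_derivBoundedSet f.2 i
  have hK : TendstoUniformlyOn (fun (f : derivBoundedSet F K B) x => iteratedFDeriv ℝ i f.1 x)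
      (fun x => p x i) l (K : Set E) := by
    have := (EquicontinuousOn.tendsto_uniformOnFun_iff_pi' (𝔖 := {(K : Set E)})
      (F := fun (f : derivBoundedSet F K B) x => iteratedFDeriv ℝ i f.1 x)
      (by simpa using K.isCompact) (fun _ _ => hequi.equicontinuous.equicontinuousOn _) l
      fun x => p x i).2 (tendsto_pi_nhds.2 fun x => hp x.1 i)
    exact UniformOnFun.tendsto_iff_tendstoUniformlyOn.1 this _ rfl
  rw [Metric.tendstoUniformlyOn_iff] at hK
  refine Metric.tendstoUniformly_iff.2 fun ε hε => ?_
  filter_upwards [hK ε hε] with f hf x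
  by_cases hx : x ∈ K
  · exact hf x hx
  · rw [eq_zero_of_tendsto_iteratedFDeriv (hp x i) hx, f.1.iteratedFDeriv_zero_on_compl hx]
    simpa using hε

theorem hasFTaylorSeriesUpTo_of_tendsto_iteratedFDeriv
    (hp : ∀ x i, Tendsto (fun f : derivBoundedSet F K B => iteratedFDeriv ℝ i f.1 x) l
      (𝓝 (p x i))) :
    HasFTaylorSeriesUpTo ∞ (fun x => (p x 0).curry0) p := by
  have hunif := tendstoUniformly_iteratedFDeriv hp
  refine ⟨fun _ => rfl, fun i _ x => ?_, fun i _ => ?_⟩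
  · have hcurry := (continuousMultilinearCurryLeftEquiv ℝ (fun _ : Fin (i + 1) => E) F).isometry
    refine hasFDerivAt_of_tendstoUniformly (𝕜 := ℝ) (l := l)
      (f := fun f x => iteratedFDeriv ℝ i f.1 x)
      (f' := fun f x => (iteratedFDeriv ℝ (i + 1) f.1 x).curryLeft)
      (g' := fun x => (p x (i + 1)).curryLeft)
      (hcurry.uniformContinuous.comp_tendstoUniformly (hunif (i + 1))) (fun f x => ?_)
      (fun x => hp x i) x
    have := (f.1.contDiff.differentiable_iteratedFDeriv
      (m := i) (mod_cast ENat.natCast_lt_top i) x).hasFDerivAt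
    rwa [fderiv_iteratedFDeriv] at this
  · exact (hunif i).continuous <| Frequently.of_forall fun f =>
      f.1.contDiff.continuous_iteratedFDeriv (mod_cast le_top)

theorem exists_mem_derivBoundedSet_tendsto
    (hp : ∀ x i, Tendsto (fun f : derivBoundedSet F K B => iteratedFDeriv ℝ i f.1 x) l
      (𝓝 (p x i))) :
    ∃ G ∈ derivBoundedSet F K B, Tendsto (fun f : derivBoundedSet F K B => f.1) l (𝓝 G) := by
  have hT := hasFTaylorSeriesUpTo_of_tendsto_iteratedFDeriv hp
  have hder : ∀ i x, iteratedFDeriv ℝ i (fun x => (p x 0).curry0) x = p x i := fun i x =>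
    (hT.eq_iteratedFDeriv (m := i) (mod_cast le_top) x).symm
  let G : 𝓓_{K}(E, F) := ⟨fun x => (p x 0).curry0, hT.contDiff, fun x hx => by
    simp [eq_zero_of_tendsto_iteratedFDeriv (hp x 0) hx]⟩
  have hG : ∀ i, iteratedFDeriv ℝ i G = fun x => p x i := fun i => funext (hder i)
  refine ⟨G, fun i x => ?_, ?_⟩
  · rw [hG]
    exact le_of_tendsto (hp x i).norm (Eventually.of_forall fun f => f.2 i x)
  · rw [(ContDiffMapSupportedIn.isUniformEmbedding_pi_structureMapCLM
      (𝕜 := ℝ) (E := E) (F := F) (n := ⊤) (K := K)).isInducing.tendsto_nhds_iff, tendsto_pi_nhds]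
    intro i
    have hstr : ∀ f : 𝓓_{K}(E, F), ⇑(ContDiffMapSupportedIn.structureMapCLM ℝ ⊤ i f)
        = iteratedFDeriv ℝ i f := ContDiffMapSupportedIn.structureMapCLM_top_apply ℝ
    rw [BoundedContinuousFunction.tendsto_iff_tendstoUniformly]
    simpa [hstr, hG, Function.comp_def] using tendstoUniformly_iteratedFDeriv hp i

end Limit

theorem isCompact_derivBoundedSet [FiniteDimensional ℝ E] [FiniteDimensional ℝ F]
    (K : Compacts E) (B : ℕ → ℝ) : IsCompact (derivBoundedSet F K B) := by
  rw [isCompact_iff_compactSpace, ← isCompact_univ_iff, isCompact_iff_ultrafilter_le_nhds]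
  intro U _
  obtain ⟨p, hp⟩ := exists_tendsto_iteratedFDeriv U
  obtain ⟨G, hG, hlim⟩ := exists_mem_derivBoundedSet_tendsto hp
  refine ⟨⟨G, hG⟩, trivial, ?_⟩
  rw [nhds_subtype, ← map_le_iff_le_comap]
  exact hlim

end Montel

section CompactSets

variable {E F : Type*} [NormedAddCommGroup E] [NormedSpace ℝ E]
  [NormedAddCommGroup F] [NormedSpace ℝ F] {Ω : Opens E}

theorem exists_clm_boundedContinuousFunction {X G : Type*} [TopologicalSpace X]
    [DiscreteTopology X] [NormedAddCommGroup G] [NormedSpace ℝ G]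
    (D : 𝓓(Ω, F) →ₗ[ℝ] (X → G))
    (hD : ∀ (K : Compacts E) (hK : (K : Set E) ⊆ Ω), ∃ (s : Finset ℕ) (C : ℝ), 0 ≤ C ∧
      ∀ (f : 𝓓_{K}(E, F)) x, ‖D (TestFunction.ofSupportedIn hK f) x‖ ≤
        C * (s.sup fun i => ContDiffMapSupportedIn.seminorm ℝ E F ⊤ K i) f) :
    ∃ Φ : 𝓓(Ω, F) →L[ℝ] BoundedContinuousFunction X G, ∀ f x, Φ f x = D f x := by
  have hbd : ∀ f, ∃ C, ∀ x, ‖D f x‖ ≤ C := by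
    intro f
    obtain ⟨s, C, -, h⟩ := hD ⟨tsupport f, f.hasCompactSupport⟩ f.tsupport_subset
    exact ⟨_, h ⟨f, f.contDiff, fun x hx => image_eq_zero_of_notMem_tsupport hx⟩⟩
  choose C hC using hbd
  let Φ : 𝓓(Ω, F) → BoundedContinuousFunction X G := fun f =>
    BoundedContinuousFunction.ofNormedAddCommGroupDiscrete (D f) (C f) (hC f)
  refine ⟨TestFunction.limitCLM ℝ Φ
    (fun K hK => ContDiffMapSupportedIn.mkCLMtoNormedSpace ℝ
      (fun f => Φ (TestFunction.ofSupportedIn hK f)) (fun f g => ?_) (fun a f => ?_) ?_)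
    fun _ _ _ => rfl, fun _ _ => rfl⟩
  · ext x
    exact congrFun (map_add D (.ofSupportedIn hK f) (.ofSupportedIn hK g)) x
  · ext x
    exact congrFun (map_smul D a (.ofSupportedIn hK f)) x
  · obtain ⟨s, C, hC, h⟩ := hD K hK
    refine ⟨s, C, hC, fun f => ?_⟩
    rw [BoundedContinuousFunction.norm_le (mul_nonneg hC (apply_nonneg _ _))]
    exact h f

theorem exists_bound_of_isCompact {X G : Type*} [NormedAddCommGroup G] [NormedSpace ℝ G]
    (D : 𝓓(Ω, F) →ₗ[ℝ] (X → G))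
    (hD : ∀ (K : Compacts E) (hK : (K : Set E) ⊆ Ω), ∃ (s : Finset ℕ) (C : ℝ), 0 ≤ C ∧
      ∀ (f : 𝓓_{K}(E, F)) x, ‖D (TestFunction.ofSupportedIn hK f) x‖ ≤
        C * (s.sup fun i => ContDiffMapSupportedIn.seminorm ℝ E F ⊤ K i) f)
    {S : Set 𝓓(Ω, F)} (hS : IsCompact S) :
    ∃ R, 0 ≤ R ∧ ∀ f ∈ S, ∀ x, ‖D f x‖ ≤ R := by
  let : TopologicalSpace X := ⊥
  have : DiscreteTopology X := ⟨rfl⟩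
  obtain ⟨Φ, hΦ⟩ := exists_clm_boundedContinuousFunction D hD
  obtain ⟨R, hR⟩ := (hS.image Φ.continuous).isBounded.exists_norm_le
  refine ⟨max R 0, le_max_right _ _, fun f hf x => ?_⟩
  rw [← hΦ]
  exact (((Φ f).norm_coe_le_norm x).trans (hR _ ⟨f, hf, rfl⟩)).trans (le_max_left _ _)

theorem exists_compact_exhaustion {X : Type*} [TopologicalSpace X] [LocallyCompactSpace X]
    [SecondCountableTopology X] (Ω : Opens X) :
    ∃ K : ℕ → Compacts X, (∀ n, (K n : Set X) ⊆ Ω) ∧ Monotone K ∧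
      ∀ L : Set X, IsCompact L → L ⊆ Ω → ∃ n, L ⊆ K n := by
  have : LocallyCompactSpace Ω := Ω.isOpen.locallyCompactSpace
  let K := CompactExhaustion.choice Ω
  refine ⟨fun n => ⟨Subtype.val '' K n, (K.isCompact n).image continuous_subtype_val⟩,
    fun n => Subtype.coe_image_subset _ _, fun m n h => Set.image_mono (K.subset h),
    fun L hL hLΩ => ?_⟩
  have hL' : IsCompact (Subtype.val ⁻¹' L : Set Ω) :=
    Topology.IsInducing.subtypeVal.isCompact_preimage' hL (by simpa using hLΩ)
  obtain ⟨n, hn⟩ := K.exists_superset_of_isCompact hL'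
  exact ⟨n, fun x hx => ⟨⟨x, hLΩ hx⟩, hn hx, rfl⟩⟩

theorem exists_bound_smul_apply_of_isCompact {C : Set 𝓓(Ω, F)} (hC : IsCompact C) (x : ℕ → E)
    (hx : ∀ L : Set E, IsCompact L → L ⊆ Ω → ∃ N, ∀ n ≥ N, x n ∉ L) (c : ℕ → ℝ) :
    ∃ R, ∀ f ∈ C, ∀ n, ‖c n • f (x n)‖ ≤ R := by
  let D : 𝓓(Ω, F) →ₗ[ℝ] (ℕ → F) :=
    { toFun := fun f n => c n • f (x n)
      map_add' := fun f g => by ext n; simp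
      map_smul' := fun a f => by ext n; simp [smul_comm a] }
  suffices h : ∀ L : Compacts E, (L : Set E) ⊆ Ω → ∃ (s : Finset ℕ) (C : ℝ), 0 ≤ C ∧
      ∀ (f : 𝓓_{L}(E, F)) n, ‖c n • f (x n)‖ ≤
        C * (s.sup fun i => ContDiffMapSupportedIn.seminorm ℝ E F ⊤ L i) f by
    obtain ⟨R, -, hR⟩ := exists_bound_of_isCompact D h hC
    exact ⟨R, hR⟩
  intro L hL
  obtain ⟨N, hN⟩ := hx L L.isCompact hL
  refine ⟨{0}, ∑ k ∈ Finset.range N, |c k|, by positivity, fun f n => ?_⟩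
  rw [Finset.sup_singleton]
  rcases lt_or_ge n N with h | h
  · rw [norm_smul, Real.norm_eq_abs]
    gcongr
    · exact Finset.single_le_sum (f := fun k => |c k|) (fun _ _ => abs_nonneg _)
        (Finset.mem_range.2 h)
    · exact ContDiffMapSupportedIn.norm_apply_le_seminorm ℝ
  · rw [f.zero_on_compl (hN n h)]
    simp only [Pi.zero_apply, smul_zero, norm_zero]
    positivity

/- Otherwise some `f n ∈ C` would satisfy `f n (x n) ≠ 0` with `x n` leaving every compact set,
and the continuous linear map `g ↦ (n • ‖f n (x n)‖⁻¹ • g (x n))ₙ` would be unbounded on `C`. -/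
theorem exists_common_support [FiniteDimensional ℝ E] {C : Set 𝓓(Ω, F)} (hC : IsCompact C) :
    ∃ K : Compacts E, (K : Set E) ⊆ Ω ∧ ∀ f ∈ C, Set.EqOn f 0 (K : Set E)ᶜ := by
  have : ProperSpace E := FiniteDimensional.proper ℝ E
  obtain ⟨K, hKΩ, hKm, hKe⟩ := exists_compact_exhaustion Ω
  by_contra! hcon
  have hescape : ∀ n, ∃ f ∈ C, ∃ x ∉ K n, f x ≠ 0 := fun n => by
    simpa [Set.EqOn] using hcon (K n) (hKΩ n)
  choose f hfC x hxK hfx using hescape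
  obtain ⟨R, hR⟩ := exists_bound_smul_apply_of_isCompact hC x (fun L hL hLΩ => by
    obtain ⟨N, hN⟩ := hKe L hL hLΩ
    exact ⟨N, fun n hn hx => hxK n (hKm hn (hN hx))⟩) fun n => n / ‖f n (x n)‖
  obtain ⟨n, hn⟩ := exists_nat_gt R
  have hnR := hR (f n) (hfC n) n
  rw [norm_smul, norm_div, norm_norm, div_mul_cancel₀ _ (norm_ne_zero_iff.2 (hfx n)),
    RCLike.norm_natCast] at hnR
  exact hnR.not_gt hn

theorem exists_bound_iteratedFDeriv_of_isCompact {C : Set 𝓓(Ω, F)} (hC : IsCompact C) (i : ℕ) :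
    ∃ R, 0 ≤ R ∧ ∀ f ∈ C, ∀ x, ‖iteratedFDeriv ℝ i f x‖ ≤ R := by
  let D : 𝓓(Ω, F) →ₗ[ℝ] (E → E [×i]→L[ℝ] F) :=
    { toFun := fun f => iteratedFDeriv ℝ i f
      map_add' := fun f g => iteratedFDeriv_add (f.contDiff.of_le (mod_cast le_top))
        (g.contDiff.of_le (mod_cast le_top))
      map_smul' := fun a f => funext fun x =>
        iteratedFDeriv_const_smul_apply (f.contDiff.contDiffAt.of_le (mod_cast le_top)) }
  refine exists_bound_of_isCompact D (fun L hL => ⟨{i}, 1, zero_le_one, fun f x => ?_⟩) hC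
  rw [Finset.sup_singleton, one_mul]
  exact ContDiffMapSupportedIn.norm_iteratedFDeriv_apply_le_seminorm_top ℝ

theorem exists_derivBoundedSet_superset [FiniteDimensional ℝ E] {C : Set 𝓓(Ω, F)}
    (hC : IsCompact C) :
    ∃ (K : Compacts E) (hK : (K : Set E) ⊆ Ω) (B : ℕ → ℝ), (∀ i, 0 ≤ B i) ∧
      C ⊆ TestFunction.ofSupportedIn hK '' derivBoundedSet F K B := by
  obtain ⟨K, hK, hsupp⟩ := exists_common_support hC
  choose B hB0 hB using exists_bound_iteratedFDeriv_of_isCompact hC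
  exact ⟨K, hK, B, hB0, fun f hf =>
    ⟨⟨f, f.contDiff, hsupp f hf⟩, fun i x => hB i f hf x, rfl⟩⟩

end CompactSets

section DerivBoundedSet

variable {E F : Type*} [NormedAddCommGroup E] [NormedSpace ℝ E]
  [NormedAddCommGroup F] [NormedSpace ℝ F] {K : Compacts E} {B : ℕ → ℝ}

theorem derivBoundedSet_eq_iInter_closedBall (𝕜 : Type*) [RCLike 𝕜] [NormedSpace 𝕜 F]
    [IsScalarTower ℝ 𝕜 F] (hB : ∀ i, 0 ≤ B i) :
    derivBoundedSet F K B =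
      ⋂ i, (ContDiffMapSupportedIn.seminorm 𝕜 E F ⊤ K i).closedBall 0 (B i) := by
  ext f
  simp only [derivBoundedSet, Set.mem_ofPred_eq, Set.mem_iInter, Seminorm.mem_closedBall_zero,
    ContDiffMapSupportedIn.seminorm_apply, BoundedContinuousFunction.norm_le (hB _),
    ContDiffMapSupportedIn.structureMapCLM_top_apply]

theorem convex_derivBoundedSet (hB : ∀ i, 0 ≤ B i) : Convex ℝ (derivBoundedSet F K B) := by
  rw [derivBoundedSet_eq_iInter_closedBall ℝ hB]
  exact convex_iInter fun i => Seminorm.convex_closedBall _ _ _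

theorem balanced_derivBoundedSet {𝕜 : Type*} [RCLike 𝕜] [NormedSpace 𝕜 F] [IsScalarTower ℝ 𝕜 F]
    (hB : ∀ i, 0 ≤ B i) : Balanced 𝕜 (derivBoundedSet F K B) := by
  rw [derivBoundedSet_eq_iInter_closedBall 𝕜 hB]
  exact balanced_iInter fun i => Seminorm.balanced_closedBall_zero _ _

end DerivBoundedSet

section Duality

variable {𝕜 X : Type*} [RCLike 𝕜] [AddCommGroup X] [Module 𝕜 X] [TopologicalSpace X]

theorem continuous_of_compact_bound
    (Λ : (X →L_c[𝕜] 𝕜) →ₗ[𝕜] 𝕜) {C : Set X} (hC : IsCompact C) (c : ℝ)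
    (h : ∀ (S : X →L_c[𝕜] 𝕜) (u : ℝ), 0 ≤ u → (∀ x ∈ C, ‖S x‖ ≤ u) → ‖Λ S‖ ≤ c * u) :
    Continuous Λ := by
  refine continuous_of_continuousAt_zero Λ ?_
  rw [ContinuousAt, map_zero, Metric.nhds_basis_ball.tendsto_right_iff]
  intro ε hε
  refine (CompactConvergenceCLM.hasBasis_nhds_zero_of_basis (σ := RingHom.id 𝕜)
      (E := X) (F := 𝕜) Metric.nhds_basis_ball).mem_iff.2
    ⟨(C, ε / (|c| + 1)), ⟨hC, by positivity⟩, fun S hS => mem_ball_zero_iff.2 ?_⟩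
  refine (h S (ε / (|c| + 1)) (by positivity)
    fun x hx => (mem_ball_zero_iff.1 (hS x hx)).le).trans_lt ?_
  rw [← mul_div_assoc, div_lt_iff₀ (by positivity)]
  nlinarith [le_abs_self c]

variable [Module ℝ X] [IsScalarTower ℝ 𝕜 X]

theorem exists_isCompact_bound [ContinuousConstSMul ℝ X] (Λ : (X →L_c[𝕜] 𝕜) →L[𝕜] 𝕜) :
    ∃ C : Set X, IsCompact C ∧
      ∀ (S : X →L_c[𝕜] 𝕜) (u : ℝ), 0 < u → (∀ x ∈ C, ‖S x‖ ≤ u) → ‖Λ S‖ ≤ u := by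
  have hball : {S : X →L_c[𝕜] 𝕜 | ‖Λ S‖ < 1} ∈ 𝓝 0 :=
    (isOpen_lt Λ.continuous.norm continuous_const).mem_nhds (by simp)
  obtain ⟨⟨C, ε⟩, ⟨hC, hε : 0 < ε⟩, hsub⟩ :=
    (CompactConvergenceCLM.hasBasis_nhds_zero_of_basis (σ := RingHom.id 𝕜)
      (E := X) (F := 𝕜) Metric.nhds_basis_ball).mem_iff.1 hball
  refine ⟨(fun x => (2 / ε : ℝ) • x) '' C, hC.image (continuous_const_smul _),
    fun S u hu hS => ?_⟩
  have hscaled : ‖Λ ((u : 𝕜)⁻¹ • S)‖ < 1 := hsub fun x hx => mem_ball_zero_iff.2 ?_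
  · rw [map_smul, norm_smul, norm_inv, RCLike.norm_ofReal, abs_of_pos hu, inv_mul_lt_iff₀ hu,
      mul_one] at hscaled
    exact hscaled.le
  · have hx : 2 / ε * ‖S x‖ ≤ u := by
      have hSx : ‖S ((2 / ε : ℝ) • x)‖ ≤ u := hS _ ⟨x, hx, rfl⟩
      rwa [← algebraMap_smul 𝕜 (2 / ε) x, map_smul, norm_smul, norm_algebraMap',
        Real.norm_of_nonneg (by positivity)] at hSx
    change ‖(u : 𝕜)⁻¹ • S x‖ < ε
    rw [norm_smul, norm_inv, RCLike.norm_ofReal, abs_of_pos hu, inv_mul_lt_iff₀ hu]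
    rw [div_mul_eq_mul_div, div_le_iff₀ hε] at hx
    nlinarith [mul_pos hu hε]

theorem exists_mem_forall_apply_eq {ι : Type*} [Fintype ι] {Γ : Set X} (hΓne : Γ.Nonempty)
    (hΓc : IsCompact Γ) (hΓ : Convex ℝ Γ) (hbal : Balanced 𝕜 Γ) (S : ι → X →L[𝕜] 𝕜) (v : ι → 𝕜)
    (hv : ∀ (c : ι → 𝕜) (u : ℝ), 0 < u → (∀ x ∈ Γ, ‖∑ i, c i * S i x‖ ≤ u) →
      ‖∑ i, c i * v i‖ ≤ u) :
    ∃ x ∈ Γ, ∀ i, S i x = v i := by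
  classical
  let P : X →L[𝕜] (ι → 𝕜) := ContinuousLinearMap.pi S
  by_contra hcon
  have hvP : v ∉ P '' Γ := by
    rintro ⟨x, hx, hxv⟩
    exact hcon ⟨x, hx, fun i => congrFun hxv i⟩
  obtain ⟨g, u, hgu, hug⟩ := RCLike.geometric_hahn_banach_closed_point (𝕜 := 𝕜)
    (hΓ.linear_image ((P : X →ₗ[𝕜] (ι → 𝕜)).restrictScalars ℝ))
    (hΓc.image P.continuous).isClosed hvP
  have hg : ∀ w : ι → 𝕜, ∑ i, g (Pi.single i 1) * w i = g w := fun w => by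
    conv_rhs => rw [pi_eq_sum_univ' w]
    simp only [map_sum, map_smul, smul_eq_mul, mul_comm]
  have hu : 0 < u := by simpa using hgu 0 ⟨0, hbal.zero_mem hΓne, map_zero _⟩
  have hle : ‖g v‖ ≤ u := by
    rw [← hg]
    refine hv _ u hu fun x hx => ?_
    change ‖∑ i, g (Pi.single i 1) * P x i‖ ≤ u
    rw [hg]
    obtain ⟨c, hc, hnorm⟩ := RCLike.exists_norm_eq_mul_self (g (P x))
    have hcx : RCLike.re (g (P (c • x))) < u := hgu _ ⟨c • x, hbal.smul_mem hc.le hx, rfl⟩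
    rw [map_smul, map_smul, smul_eq_mul, ← hnorm, RCLike.ofReal_re] at hcx
    exact hcx.le
  exact absurd (hug.trans_le (RCLike.re_le_norm _)) (not_lt.2 hle)

/- The Mackey–Arens theorem: `Λ` is bounded by a set `Γ`, so by Hahn–Banach finitely many of its
values are attained at a point of `Γ`, and by compactness all of them are. -/
theorem exists_forall_eq_apply
    (hX : ∀ C : Set X, IsCompact C → ∃ Γ, C ⊆ Γ ∧ IsCompact Γ ∧ Convex ℝ Γ ∧ Balanced 𝕜 Γ)
    [ContinuousConstSMul ℝ X] (Λ : (X →L_c[𝕜] 𝕜) →L[𝕜] 𝕜) :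
    ∃ x : X, ∀ S : X →L_c[𝕜] 𝕜, Λ S = S x := by
  obtain ⟨C, hC, hΛ⟩ := exists_isCompact_bound Λ
  obtain ⟨Γ, hCΓ, hΓc, hΓ, hbal⟩ := hX _ (hC.insert 0)
  obtain ⟨x, -, hx⟩ := hΓc.inter_iInter_nonempty (fun S : X →L_c[𝕜] 𝕜 => {x | S x = Λ S})
    (fun S => isClosed_eq (map_continuous S) continuous_const) (fun t => by
      obtain ⟨x, hx, hxt⟩ := exists_mem_forall_apply_eq ⟨0, hCΓ (Set.mem_insert _ _)⟩ hΓc hΓ hbal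
        (fun S : t => S.1) (fun S : t => Λ S.1) (fun c u hu hS => by
          have hΛt := hΛ (∑ i : t, c i • i.1) u hu fun x hx => by
            rw [sum_apply]
            exact hS x (hCΓ (Set.mem_insert_of_mem _ hx))
          simpa only [map_sum, map_smul, smul_eq_mul] using hΛt)
      exact ⟨x, hx, Set.mem_iInter₂.2 fun S hS => hxt ⟨S, hS⟩⟩)
  exact ⟨x, fun S => (Set.mem_iInter.1 hx S).symm⟩

end Duality

section TestFunctionDual

variable {𝕜 E : Type*} [RCLike 𝕜] [NormedAddCommGroup E] [NormedSpace ℝ E]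
  [FiniteDimensional ℝ E] {Ω : Opens E}

theorem exists_isCompact_convex_balanced_superset {C : Set 𝓓(Ω, 𝕜)} (hC : IsCompact C) :
    ∃ Γ, C ⊆ Γ ∧ IsCompact Γ ∧ Convex ℝ Γ ∧ Balanced 𝕜 Γ := by
  obtain ⟨K, hK, B, hB, hCB⟩ := exists_derivBoundedSet_superset hC
  refine ⟨_, hCB, (isCompact_derivBoundedSet K B).image (TestFunction.continuous_ofSupportedIn hK),
    ?_, ?_⟩
  · rintro _ ⟨f, hf, rfl⟩ _ ⟨g, hg, rfl⟩ a b ha hb hab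
    exact ⟨a • f + b • g, convex_derivBoundedSet hB hf hg ha hb hab, rfl⟩
  · rw [balanced_iff_smul_mem]
    rintro a ha _ ⟨f, hf, rfl⟩
    exact ⟨a • f, (balanced_derivBoundedSet hB).smul_mem ha hf, rfl⟩

theorem exists_testFunction_forall_eq_apply (Λ : (𝓓(Ω, 𝕜) →L_c[𝕜] 𝕜) →L[𝕜] 𝕜) :
    ∃ φ : 𝓓(Ω, 𝕜), ∀ S : 𝓓(Ω, 𝕜) →L_c[𝕜] 𝕜, Λ S = S φ :=
  exists_forall_eq_apply (fun _ => exists_isCompact_convex_balanced_superset) Λ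

end TestFunctionDual

section WeakIntegral

variable {𝕜 E : Type*} [RCLike 𝕜] [NormedAddCommGroup E] [NormedSpace ℝ E] {Ω : Opens E}

/-- The evaluation at a point, as a distribution. -/
def diracDistribution (𝕜 : Type*) [RCLike 𝕜] (Ω : Opens E) (x : E) : 𝓓(Ω, 𝕜) →L_c[𝕜] 𝕜 :=
  ({ toFun := fun φ => φ x
     map_add' := fun _ _ => rfl
     map_smul' := fun _ _ => rfl
     cont := continuous_eval_const x } : 𝓓(Ω, 𝕜) →L[𝕜] 𝕜)

variable [FiniteDimensional ℝ E] {Y : Type*} [TopologicalSpace Y] [T2Space Y] [MeasurableSpace Y]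
  [OpensMeasurableSpace Y] (μ : Measure Y) [IsFiniteMeasureOnCompacts μ] {κ : Set Y}
  {γ : Y → 𝓓(Ω, 𝕜)}

theorem exists_weak_integral (hκ : IsCompact κ) (hγ : ContinuousOn γ κ) :
    ∃ g : 𝓓(Ω, 𝕜), ∀ S : 𝓓(Ω, 𝕜) →L_c[𝕜] 𝕜, S g = ∫ y in κ, S (γ y) ∂μ := by
  have hInt : ∀ S : 𝓓(Ω, 𝕜) →L_c[𝕜] 𝕜, IntegrableOn (fun y => S (γ y)) κ μ := fun S =>
    ((map_continuous S).comp_continuousOn hγ).integrableOn_compact hκ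
  let Λ : (𝓓(Ω, 𝕜) →L_c[𝕜] 𝕜) →ₗ[𝕜] 𝕜 :=
    { toFun := fun S => ∫ y in κ, S (γ y) ∂μ
      map_add' := fun S T => integral_add (hInt S) (hInt T)
      map_smul' := fun c S => integral_const_mul c _ }
  have hΛ : Continuous Λ := by
    refine continuous_of_compact_bound Λ (hκ.image_of_continuousOn hγ) (μ.real κ)
      fun S u _ hS => ?_
    rw [mul_comm]
    exact norm_setIntegral_le_of_norm_le_const hκ.measure_lt_top fun y hy => hS _ ⟨y, hy, rfl⟩
  obtain ⟨g, hg⟩ := exists_testFunction_forall_eq_apply ⟨Λ, hΛ⟩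
  exact ⟨g, fun S => (hg S).symm⟩

theorem apply_eq_setIntegral_of_forall (hκ : IsCompact κ) (hγ : ContinuousOn γ κ)
    {g : 𝓓(Ω, 𝕜)} (hg : ∀ x, g x = ∫ y in κ, γ y x ∂μ) (S : 𝓓(Ω, 𝕜) →L_c[𝕜] 𝕜) :
    S g = ∫ y in κ, S (γ y) ∂μ := by
  obtain ⟨g', hg'⟩ := exists_weak_integral μ hκ hγ
  have hgg' : g = g' := by
    ext x
    rw [hg]
    exact (hg' (diracDistribution 𝕜 Ω x)).symm
  rw [hgg', hg']

end WeakIntegral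

section Families

variable {𝕜 E P : Type*} [RCLike 𝕜] [NormedAddCommGroup E] [NormedSpace ℝ E]
  [NormedAddCommGroup P] [NormedSpace ℝ P] {Ω : Opens E} {K : Compacts E}

theorem exists_norm_apply_ofSupportedIn_le (T : 𝓓(Ω, 𝕜) →L_c[𝕜] 𝕜) (hK : (K : Set E) ⊆ Ω) :
    ∃ (m : ℕ) (C : ℝ), 0 ≤ C ∧ ∀ (f : 𝓓_{K}(E, 𝕜)) (M : ℝ),
      (∀ k ≤ m, ∀ x, ‖iteratedFDeriv ℝ k f x‖ ≤ M) →
        ‖T (TestFunction.ofSupportedIn hK f)‖ ≤ C * M := by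
  let Λ : 𝓓_{K}(E, 𝕜) →L[𝕜] 𝕜 :=
    (show 𝓓(Ω, 𝕜) →L[𝕜] 𝕜 from T).comp (TestFunction.ofSupportedInCLM 𝕜 hK)
  obtain ⟨s, C, -, hΛ⟩ := Seminorm.bound_of_continuous
    (ContDiffMapSupportedIn.withSeminorms 𝕜 E 𝕜 ⊤ K)
    ((normSeminorm 𝕜 𝕜).comp (Λ : 𝓓_{K}(E, 𝕜) →ₗ[𝕜] 𝕜)) Λ.continuous.norm
  refine ⟨s.sup id, C, C.2, fun f M hM => (hΛ f).trans ?_⟩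
  have hM₀ : 0 ≤ M := (norm_nonneg _).trans (hM 0 (Nat.zero_le _) 0)
  refine mul_le_mul_of_nonneg_left (Seminorm.finset_sup_apply_le hM₀ fun k hk => ?_) C.2
  rw [ContDiffMapSupportedIn.seminorm_top_le_iff _ hM₀]
  exact fun x _ => hM k (Finset.le_sup (f := id) hk) x

/-- A smooth family of test functions supported in `K`, written as one function of the space
variable and of the parameter. -/
structure IsTestFamily (K : Compacts E) (F : E × P → 𝕜) : Prop where
  contDiff : ContDiff ℝ ∞ F
  eq_zero_of_notMem : ∀ x ∉ K, ∀ p, F (x, p) = 0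

namespace IsTestFamily

variable {F : E × P → 𝕜}

/-- The member `F (·, p)` of a family of test functions. -/
def slice (hF : IsTestFamily K F) (p : P) : 𝓓_{K}(E, 𝕜) where
  toFun x := F (x, p)
  contDiff' := hF.contDiff.comp (contDiff_id.prodMk contDiff_const)
  zero_on_compl' x hx := hF.eq_zero_of_notMem x hx p

theorem iteratedFDeriv_slice (hF : IsTestFamily K F) (p : P) (i : ℕ) (x : E) :
    iteratedFDeriv ℝ i (hF.slice p) x =
      (iteratedFDeriv ℝ i F (x, p)).compContinuousLinearMap
        fun _ => ContinuousLinearMap.inl ℝ E P := by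
  have hslice : (hF.slice p : E → 𝕜) =
      (fun z => F (z + (0, p))) ∘ ContinuousLinearMap.inl ℝ E P := by
    ext y
    change F (y, p) = F ((y, 0) + (0, p))
    simp
  rw [hslice, ContinuousLinearMap.iteratedFDeriv_comp_right (n := ∞)
    (ContinuousLinearMap.inl ℝ E P) (f := fun z : E × P => F (z + (0, p)))
    (hF.contDiff.comp (contDiff_id.add contDiff_const)) x (mod_cast le_top),
    iteratedFDeriv_comp_add_right]
  simp

theorem norm_iteratedFDeriv_slice_le (hF : IsTestFamily K F) (p : P) (i : ℕ) (x : E) :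
    ‖iteratedFDeriv ℝ i (hF.slice p) x‖ ≤ ‖iteratedFDeriv ℝ i F (x, p)‖ := by
  rw [hF.iteratedFDeriv_slice]
  refine (ContinuousMultilinearMap.norm_compContinuousLinearMap_le _ _).trans ?_
  refine mul_le_of_le_one_right (norm_nonneg _) (Finset.prod_le_one (fun _ _ => norm_nonneg _) ?_)
  exact fun _ _ => ContinuousLinearMap.norm_inl_le_one ℝ E P

theorem continuous_uncurry_iteratedFDeriv_slice (hF : IsTestFamily K F) (i : ℕ) :
    Continuous (Function.uncurry fun (p : P) (x : E) => iteratedFDeriv ℝ i (hF.slice p) x) := by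
  have huncurry : (Function.uncurry fun (p : P) (x : E) => iteratedFDeriv ℝ i (hF.slice p) x) =
      fun z : P × E => ContinuousMultilinearMap.compContinuousLinearMapL
        (fun _ => ContinuousLinearMap.inl ℝ E P) (iteratedFDeriv ℝ i F (z.2, z.1)) := by
    ext1 z
    exact hF.iteratedFDeriv_slice z.1 i z.2
  rw [huncurry]
  exact (ContinuousLinearMap.continuous _).comp
    ((hF.contDiff.continuous_iteratedFDeriv (mod_cast le_top)).comp continuous_swap)

theorem continuous_slice (hF : IsTestFamily K F) : Continuous hF.slice := by
  refine (ContDiffMapSupportedIn.continuous_iff_comp _).2 fun i => ?_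
  refine continuous_iff_continuousAt.2 fun p₀ => ?_
  rw [ContinuousAt, BoundedContinuousFunction.tendsto_iff_tendstoUniformly,
    Metric.tendstoUniformly_iff]
  intro ε hε
  obtain ⟨v, hv, hvε⟩ := K.isCompact.mem_uniformity_of_prod
    ((hF.continuous_uncurry_iteratedFDeriv_slice i).continuousOn (s := Set.univ ×ˢ K))
    (Set.mem_univ p₀) (Metric.dist_mem_uniformity hε)
  rw [nhdsWithin_univ] at hv
  filter_upwards [hv] with p hp x
  rw [Function.comp_apply, Function.comp_apply, ContDiffMapSupportedIn.structureMapCLM_top_apply,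
    ContDiffMapSupportedIn.structureMapCLM_top_apply]
  by_cases hx : x ∈ K
  · rw [dist_comm]
    exact hvε p hp x hx
  · rw [ContDiffMapSupportedIn.iteratedFDeriv_zero_on_compl _ hx,
      ContDiffMapSupportedIn.iteratedFDeriv_zero_on_compl _ hx]
    simpa using hε

/-- The derivative of a family of test functions in the direction `v` of the parameter space. -/
def paramDeriv (F : E × P → 𝕜) (v : P) (z : E × P) : 𝕜 := fderiv ℝ F z (0, v)

theorem isTestFamily_paramDeriv (hF : IsTestFamily K F) (v : P) :
    IsTestFamily K (paramDeriv F v) where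
  contDiff := (hF.contDiff.fderiv_right (m := ∞) (mod_cast le_rfl)).clm_apply contDiff_const
  eq_zero_of_notMem x hx p := by
    have hzero : F =ᶠ[𝓝 (x, p)] 0 := by
      filter_upwards [(K.isCompact.isClosed.isOpen_compl.preimage continuous_fst).mem_nhds hx]
        with z hz
      exact hF.eq_zero_of_notMem z.1 hz z.2
    rw [paramDeriv, hzero.fderiv_eq]
    simp

theorem norm_iteratedFDeriv_paramDeriv_le (hF : IsTestFamily K F) (v : P) (i : ℕ) (z : E × P) :
    ‖iteratedFDeriv ℝ i (paramDeriv F v) z‖ ≤ ‖iteratedFDeriv ℝ (i + 1) F z‖ * ‖v‖ := by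
  have hclm := norm_iteratedFDeriv_clm_apply_const (𝕜 := ℝ) (f := fderiv ℝ F) (c := ((0 : E), v))
    (x := z) (N := ∞) (n := i)
    (hF.contDiff.fderiv_right (m := ∞) (mod_cast le_rfl)).contDiffAt (mod_cast le_top)
  rwa [norm_iteratedFDeriv_fderiv, Prod.norm_mk, norm_zero, max_eq_right (norm_nonneg v),
    mul_comm] at hclm

theorem hasDerivAt_line (hF : IsTestFamily K F) (x : E) (p v : P) (t : ℝ) :
    HasDerivAt (fun t : ℝ => F (x, p + t • v)) (paramDeriv F v (x, p + t • v)) t := by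
  have hline : HasDerivAt (fun t : ℝ => ((x, p + t • v) : E × P)) (0, v) t := by
    simpa using (hasDerivAt_const t x).prodMk (((hasDerivAt_id t).smul_const v).const_add p)
  exact (hF.contDiff.differentiable (by simp) (x, p + t • v)).hasFDerivAt.comp_hasDerivAt t hline

theorem sub_eq_setIntegral_paramDeriv (hF : IsTestFamily K F) (x : E) (p v : P) :
    F (x, p + v) - F (x, p) = ∫ t in Set.Icc (0 : ℝ) 1, paramDeriv F v (x, p + t • v) := by
  have hftc := intervalIntegral.integral_eq_sub_of_hasDerivAt (a := 0) (b := 1)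
    (fun t _ => hF.hasDerivAt_line x p v t)
    (((hF.isTestFamily_paramDeriv v).contDiff.continuous.comp
      (by fun_prop : Continuous fun t : ℝ => (x, p + t • v))).intervalIntegrable _ _)
  rw [intervalIntegral.integral_of_le zero_le_one, ← integral_Icc_eq_integral_Ioc] at hftc
  simpa only [one_smul, zero_smul, add_zero] using hftc.symm

variable (T : 𝓓(Ω, 𝕜) →L_c[𝕜] 𝕜) (hK : (K : Set E) ⊆ Ω)

/-- A distribution applied to the members of a family of test functions, as a function of the
parameter. -/
def pairing (hF : IsTestFamily K F) (p : P) : 𝕜 :=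
  T (TestFunction.ofSupportedIn hK (hF.slice p))

theorem continuous_pairing (hF : IsTestFamily K F) : Continuous (hF.pairing T hK) :=
  (map_continuous T).comp ((TestFunction.continuous_ofSupportedIn hK).comp hF.continuous_slice)

theorem pairing_sub_pairing [FiniteDimensional ℝ E] (hF : IsTestFamily K F) (p v : P) :
    hF.pairing T hK (p + v) - hF.pairing T hK p =
      ∫ t in Set.Icc (0 : ℝ) 1, (hF.isTestFamily_paramDeriv v).pairing T hK (p + t • v) := by
  have hline : Continuous fun t : ℝ => p + t • v := by fun_prop
  rw [pairing, pairing, ← map_sub]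
  exact apply_eq_setIntegral_of_forall volume isCompact_Icc
    (((TestFunction.continuous_ofSupportedIn hK).comp
      ((hF.isTestFamily_paramDeriv v).continuous_slice.comp hline)).continuousOn)
    (fun x => hF.sub_eq_setIntegral_paramDeriv x p v) T

/-- The derivative of `IsTestFamily.pairing`: the distribution is applied to the derivatives of the
family in the directions of the parameter space. -/
def pairingDeriv [FiniteDimensional ℝ P] (hF : IsTestFamily K F) (p : P) : P →L[ℝ] 𝕜 :=
  LinearMap.toContinuousLinearMap
    { toFun := fun v => (hF.isTestFamily_paramDeriv v).pairing T hK p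
      map_add' := fun v w => by
        rw [pairing, pairing, pairing, ← map_add]
        congr 1
        ext x
        change fderiv ℝ F (x, p) (0, v + w) =
          fderiv ℝ F (x, p) (0, v) + fderiv ℝ F (x, p) (0, w)
        rw [← map_add, Prod.mk_add_mk, add_zero]
      map_smul' := fun c v => by
        rw [pairing, pairing, RingHom.id_apply, RCLike.real_smul_eq_coe_mul, ← smul_eq_mul,
          ← map_smul]
        congr 1
        ext x
        change fderiv ℝ F (x, p) (0, c • v) = (c : 𝕜) * fderiv ℝ F (x, p) (0, v)
        rw [← RCLike.real_smul_eq_coe_mul, ← map_smul, Prod.smul_mk, smul_zero] }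

variable [FiniteDimensional ℝ P]

theorem pairingDeriv_apply (hF : IsTestFamily K F) (p v : P) :
    hF.pairingDeriv T hK p v = (hF.isTestFamily_paramDeriv v).pairing T hK p := rfl

theorem continuous_pairingDeriv (hF : IsTestFamily K F) : Continuous (hF.pairingDeriv T hK) :=
  continuous_clm_apply.2 fun v => (hF.isTestFamily_paramDeriv v).continuous_pairing T hK

variable [FiniteDimensional ℝ E]

theorem hasFDerivAt_pairing (hF : IsTestFamily K F) (p : P) :
    HasFDerivAt (hF.pairing T hK) (hF.pairingDeriv T hK p) p := by
  rw [hasFDerivAt_iff_isLittleO_nhds_zero, Asymptotics.isLittleO_iff]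
  intro ε hε
  have hcont := hF.continuous_pairingDeriv T hK
  obtain ⟨δ, hδ, hball⟩ := Metric.continuousAt_iff.1 (hcont.continuousAt (x := p)) ε hε
  filter_upwards [Metric.ball_mem_nhds (0 : P) hδ] with v hv
  rw [mem_ball_zero_iff] at hv
  have hint : IntegrableOn (fun t : ℝ => hF.pairingDeriv T hK (p + t • v) v) (Set.Icc 0 1) :=
    Continuous.integrableOn_Icc (by fun_prop)
  have hdiff : hF.pairing T hK (p + v) - hF.pairing T hK p - hF.pairingDeriv T hK p v =
      ∫ t in Set.Icc (0 : ℝ) 1,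
        (hF.pairingDeriv T hK (p + t • v) v - hF.pairingDeriv T hK p v) := by
    rw [integral_sub hint (by simp), pairing_sub_pairing]
    simp [pairingDeriv_apply]
  have hle : ∀ t ∈ Set.Icc (0 : ℝ) 1,
      ‖hF.pairingDeriv T hK (p + t • v) v - hF.pairingDeriv T hK p v‖ ≤ ε * ‖v‖ := by
    intro t ht
    rw [← sub_apply]
    refine ContinuousLinearMap.le_of_opNorm_le _ ?_ v
    rw [← dist_eq_norm]
    refine (hball ?_).le
    rw [dist_eq_norm, add_sub_cancel_left, norm_smul, Real.norm_of_nonneg ht.1]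
    exact (mul_le_of_le_one_left (norm_nonneg _) ht.2).trans_lt hv
  rw [hdiff]
  simpa using norm_setIntegral_le_of_norm_le_const (μ := volume) (by simp) hle

theorem contDiff_pairing (hF : IsTestFamily K F) : ContDiff ℝ ∞ (hF.pairing T hK) := by
  rw [contDiff_infty]
  intro n
  induction n generalizing F with
  | zero => exact contDiff_zero.2 (hF.continuous_pairing T hK)
  | succ n ih =>
    have hderiv := hF.hasFDerivAt_pairing T hK
    rw [Nat.cast_add, Nat.cast_one, contDiff_succ_iff_fderiv]
    refine ⟨fun p => (hderiv p).differentiableAt, by simp, ?_⟩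
    rw [funext fun p => (hderiv p).fderiv, contDiff_clm_apply_iff]
    exact fun v => ih (hF.isTestFamily_paramDeriv v)

theorem norm_iteratedFDeriv_succ_pairing_le (hF : IsTestFamily K F) (i : ℕ) (p : P) {B : ℝ}
    (hB : 0 ≤ B)
    (h : ∀ v, ‖iteratedFDeriv ℝ i ((hF.isTestFamily_paramDeriv v).pairing T hK) p‖ ≤ B * ‖v‖) :
    ‖iteratedFDeriv ℝ (i + 1) (hF.pairing T hK) p‖ ≤ B := by
  have hsmooth : ContDiff ℝ ∞ (hF.pairingDeriv T hK) :=
    contDiff_clm_apply_iff.2 fun v => (hF.isTestFamily_paramDeriv v).contDiff_pairing T hK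
  rw [← norm_iteratedFDeriv_fderiv, funext fun p => (hF.hasFDerivAt_pairing T hK p).fderiv]
  refine ContinuousMultilinearMap.opNorm_le_bound hB fun w =>
    ContinuousLinearMap.opNorm_le_bound _ (by positivity) fun v => ?_
  have happly : iteratedFDeriv ℝ i (hF.pairingDeriv T hK) p w v =
      iteratedFDeriv ℝ i ((hF.isTestFamily_paramDeriv v).pairing T hK) p w :=
    (iteratedFDeriv_clm_apply_const_apply hsmooth (mod_cast le_top)).symm
  rw [happly, mul_right_comm]
  exact ContinuousMultilinearMap.le_of_opNorm_le (h v) w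

theorem exists_norm_iteratedFDeriv_pairing_le (i : ℕ) :
    ∃ (m : ℕ) (C : ℝ), 0 ≤ C ∧ ∀ (F : E × P → 𝕜) (hF : IsTestFamily K F) (p : P) (M : ℝ),
      (∀ k ≤ m, ∀ x, ‖iteratedFDeriv ℝ k F (x, p)‖ ≤ M) →
        ‖iteratedFDeriv ℝ i (hF.pairing T hK) p‖ ≤ C * M := by
  induction i with
  | zero =>
    obtain ⟨m, C, hC, h⟩ := exists_norm_apply_ofSupportedIn_le T hK
    refine ⟨m, C, hC, fun F hF p M hM => ?_⟩
    rw [norm_iteratedFDeriv_zero]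
    exact h _ M fun k hk x => (hF.norm_iteratedFDeriv_slice_le p k x).trans (hM k hk x)
  | succ i ih =>
    obtain ⟨m, C, hC, h⟩ := ih
    refine ⟨m + 1, C, hC, fun F hF p M hM => ?_⟩
    have hM₀ : 0 ≤ M := (norm_nonneg _).trans (hM 0 (Nat.zero_le _) 0)
    refine hF.norm_iteratedFDeriv_succ_pairing_le T hK i p (by positivity) fun v => ?_
    rw [mul_assoc]
    exact h _ (hF.isTestFamily_paramDeriv v) p _ fun k hk x =>
      (hF.norm_iteratedFDeriv_paramDeriv_le v k (x, p)).trans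
        (mul_le_mul_of_nonneg_right (hM (k + 1) (by lia) x) (norm_nonneg _))

end IsTestFamily

end Families

section TestFunctions

variable {𝕜 E F : Type*} [RCLike 𝕜] [NormedAddCommGroup E] [NormedSpace ℝ E]
  [NormedAddCommGroup F] [NormedSpace ℝ F] {Ω : Opens E}

/-- The compact support of a test function. -/
def tsupportCompacts (φ : 𝓓(Ω, F)) : Compacts E := ⟨tsupport φ, φ.hasCompactSupport⟩

theorem tsupportCompacts_subset (φ : 𝓓(Ω, F)) : (tsupportCompacts φ : Set E) ⊆ Ω :=
  φ.tsupport_subset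

theorem testFunction_eq_zero_of_notMem (φ : 𝓓(Ω, F)) {x : E} (hx : x ∉ Ω) : φ x = 0 :=
  image_eq_zero_of_notMem_tsupport fun h => hx (φ.tsupport_subset h)

theorem testFunction_sum_apply {ι : Type*} (s : Finset ι) (g : ι → 𝓓(Ω, F)) (x : E) :
    (∑ i ∈ s, g i) x = ∑ i ∈ s, g i x :=
  map_sum (⟨⟨fun φ : 𝓓(Ω, F) => φ x, rfl⟩, fun _ _ => rfl⟩ : 𝓓(Ω, F) →+ F) g s

/-- The product of a test function on `Ω` with a real function which is smooth on `Ω`. -/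
def smoothSMul (a : E → ℝ) (ha : ContDiffOn ℝ ∞ a Ω) (f : 𝓓(Ω, F)) : 𝓓(Ω, F) where
  toFun x := a x • f x
  contDiff' := contDiff_iff_contDiffAt.2 fun x => by
    by_cases hx : x ∈ Ω
    · exact (ha.contDiffAt (Ω.isOpen.mem_nhds hx)).smul f.contDiff.contDiffAt
    · have hzero : f =ᶠ[𝓝 x] 0 :=
        notMem_tsupport_iff_eventuallyEq.1 fun h => hx (f.tsupport_subset h)
      refine (contDiffAt_const (c := (0 : F))).congr_of_eventuallyEq ?_
      filter_upwards [hzero] with y hy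
      rw [hy, Pi.zero_apply, smul_zero]
  hasCompactSupport' := f.hasCompactSupport.smul_left
  tsupport_subset' := (tsupport_smul_subset_right a f).trans f.tsupport_subset

theorem tsupport_smoothSMul_subset (a : E → ℝ) (ha : ContDiffOn ℝ ∞ a Ω) (f : 𝓓(Ω, F)) :
    tsupport (smoothSMul a ha f) ⊆ tsupport a ∩ tsupport f :=
  Set.subset_inter (tsupport_smul_subset_left a f) (tsupport_smul_subset_right a f)

section PartitionOfUnity

variable [FiniteDimensional ℝ E]

theorem exists_eq_sum_tsupport_subset (f : 𝓓(Ω, F)) {ι : Type*} (U : ι → Set E)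
    (hU : ∀ i, IsOpen (U i)) (hcov : tsupport f ⊆ ⋃ i, U i) :
    ∃ (t : Finset ι) (g : t → 𝓓(Ω, F)),
      f = ∑ i, g i ∧ ∀ i, tsupport (g i) ⊆ U i ∩ tsupport f := by
  have : ProperSpace E := FiniteDimensional.proper ℝ E
  obtain ⟨t, ht⟩ := f.hasCompactSupport.isCompact.elim_finite_subcover U hU hcov
  obtain ⟨ρ, hρ⟩ := SmoothPartitionOfUnity.exists_isSubordinate 𝓘(ℝ, E)
    (isClosed_tsupport f) (fun i : t => U i) (fun i => hU i)
    (by rwa [Set.iUnion_subtype])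
  have hsmooth : ∀ i, ContDiffOn ℝ ∞ (ρ i) Ω := fun i => (ρ i).contMDiff.contDiff.contDiffOn
  refine ⟨t, fun i => smoothSMul (ρ i) (hsmooth i) f, ?_, fun i =>
    (tsupport_smoothSMul_subset _ (hsmooth i) f).trans (Set.inter_subset_inter_left _ (hρ i))⟩
  ext x
  rw [testFunction_sum_apply]
  change f x = ∑ i, ρ i x • f x
  rw [← Finset.sum_smul]
  by_cases hx : x ∈ tsupport f
  · rw [← finsum_eq_sum_of_fintype, ρ.sum_eq_one hx, one_smul]
  · rw [image_eq_zero_of_notMem_tsupport hx, smul_zero]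

theorem exists_testFunction_eventuallyEq_one (𝕜 : Type*) [RCLike 𝕜] {Q : Set E} (hQ : IsCompact Q)
    (hQΩ : Q ⊆ Ω) : ∃ χ : 𝓓(Ω, 𝕜), ∀ᶠ x in 𝓝ˢ Q, χ x = 1 := by
  have : ProperSpace E := FiniteDimensional.proper ℝ E
  obtain ⟨Q', hQ', hQQ', hQ'Ω⟩ := exists_compact_between hQ Ω.isOpen hQΩ
  obtain ⟨f, hf_one, hf_zero, -⟩ := exists_contMDiffMap_one_nhds_of_subset_interior (n := ⊤)
    𝓘(ℝ, E) hQ.isClosed hQQ'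
  have hsupp : Function.support (fun x => (f x : 𝕜)) ⊆ Q' := by
    intro x hx
    by_contra h
    exact hx (by simp only [hf_zero x h, RCLike.ofReal_zero])
  refine ⟨⟨fun x => (f x : 𝕜), (RCLike.ofRealCLM (K := 𝕜)).contDiff.comp f.contMDiff.contDiff,
    HasCompactSupport.of_support_subset_isCompact hQ' hsupp,
    (closure_minimal hsupp hQ'.isClosed).trans hQ'Ω⟩, hf_one.mono fun x hx => ?_⟩
  change ((f x : ℝ) : 𝕜) = 1
  rw [hx, RCLike.ofReal_one]

theorem apply_eq_zero_of_disjoint_dsupport (T : 𝓓(Ω, 𝕜) →L_c[𝕜] 𝕜) {f : 𝓓(Ω, 𝕜)}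
    (h : Disjoint (tsupport f) (Distribution.dsupport T)) : T f = 0 := by
  obtain ⟨t, g, hg, hgs⟩ := exists_eq_sum_tsupport_subset f
    (fun s : {s : Set E // Distribution.IsVanishingOn T s ∧ IsOpen s} => s.1) (fun s => s.2.2)
    fun x hx => by
      obtain ⟨s, hs, hso, hxs⟩ := (Distribution.notMem_dsupport_iff x).1
        (Set.disjoint_left.1 h hx)
      exact Set.mem_iUnion.2 ⟨⟨s, hs, hso⟩, hxs⟩
  rw [hg, map_sum]
  exact Finset.sum_eq_zero fun s _ => s.1.2.1 _ ((hgs s).trans Set.inter_subset_left)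

end PartitionOfUnity

end TestFunctions

section Estimates

variable {𝕜 E X : Type*} [RCLike 𝕜] [NormedAddCommGroup E] [NormedSpace ℝ E]
  [NormedAddCommGroup X] [NormedSpace ℝ X] {Ω₁ Ω₂ : Opens E}

/-- A linear map between spaces of test functions which is bounded by finitely many seminorms on
the test functions supported in any given compact set, as a continuous linear map. -/
def clmOfBounds (A : 𝓓(Ω₁, 𝕜) → 𝓓(Ω₂, 𝕜)) (hadd : ∀ f g, A (f + g) = A f + A g)
    (hsmul : ∀ (c : 𝕜) f, A (c • f) = c • A f)
    (h : ∀ (K : Compacts E) (hK : (K : Set E) ⊆ Ω₁), ∃ Q : Compacts E, (Q : Set E) ⊆ Ω₂ ∧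
      (∀ f : 𝓓_{K}(E, 𝕜), Set.EqOn (A (TestFunction.ofSupportedIn hK f)) 0 (Q : Set E)ᶜ) ∧
      ∀ i : ℕ, ∃ (m : ℕ) (C : ℝ), 0 ≤ C ∧ ∀ (f : 𝓓_{K}(E, 𝕜)) (M : ℝ),
        (∀ k ≤ m, ∀ x, ‖iteratedFDeriv ℝ k f x‖ ≤ M) →
          ∀ x ∈ Q, ‖iteratedFDeriv ℝ i (A (TestFunction.ofSupportedIn hK f)) x‖ ≤ C * M) :
    𝓓(Ω₁, 𝕜) →L[𝕜] 𝓓(Ω₂, 𝕜) :=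
  TestFunction.mkCLM 𝕜 A hadd hsmul fun K hK => by
    obtain ⟨Q, hQ, hzero, hbound⟩ := h K hK
    let Φ : 𝓓_{K}(E, 𝕜) →L[𝕜] 𝓓_{Q}(E, 𝕜) := ContDiffMapSupportedIn.mkCLM 𝕜
      (fun f => A (TestFunction.ofSupportedIn hK f))
      (fun f g => DFunLike.congr_fun
        (hadd (TestFunction.ofSupportedIn hK f) (TestFunction.ofSupportedIn hK g)))
      (fun c f => DFunLike.congr_fun (hsmul c (TestFunction.ofSupportedIn hK f)))
      (fun f => (A (TestFunction.ofSupportedIn hK f)).contDiff) hzero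
      (fun i _ => by
        obtain ⟨m, C, hC, hm⟩ := hbound i
        refine ⟨Finset.range (m + 1), C, hC, fun f x hx => hm f _ (fun k hk x => ?_) x hx⟩
        refine (ContDiffMapSupportedIn.norm_iteratedFDeriv_apply_le_seminorm_top 𝕜).trans ?_
        exact Seminorm.le_finset_sup_apply (Finset.mem_range.2 (Nat.lt_succ_of_le hk)))
    have hfactor : A ∘ TestFunction.ofSupportedIn hK = TestFunction.ofSupportedIn hQ ∘ Φ := by
      ext f x
      rfl
    rw [hfactor]
    exact (TestFunction.continuous_ofSupportedIn hQ).comp Φ.continuous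

theorem exists_forall_norm_iteratedFDeriv_le {g : X → E} (hg : ContDiff ℝ ∞ g) {Q : Set X}
    (hQ : IsCompact Q) (m : ℕ) :
    ∃ A : ℝ, 1 ≤ A ∧ ∀ k ≤ m, ∀ z ∈ Q, ‖iteratedFDeriv ℝ k g z‖ ≤ A := by
  have h : ∀ k : ℕ, ∃ A : ℝ, ∀ z ∈ Q, ‖iteratedFDeriv ℝ k g z‖ ≤ A := fun k =>
    hQ.exists_bound_of_continuousOn (hg.continuous_iteratedFDeriv (mod_cast le_top)).continuousOn
  choose A hA using h
  refine ⟨1 + ∑ k ∈ Finset.range (m + 1), |A k|,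
    le_add_of_nonneg_right (by positivity), fun k hk z hz => ?_⟩
  calc ‖iteratedFDeriv ℝ k g z‖ ≤ |A k| := (hA k z hz).trans (le_abs_self _)
    _ ≤ ∑ k ∈ Finset.range (m + 1), |A k| :=
      Finset.single_le_sum (f := fun k => |A k|) (fun _ _ => abs_nonneg _)
        (Finset.mem_range.2 (Nat.lt_succ_of_le hk))
    _ ≤ _ := by linarith

theorem exists_norm_iteratedFDeriv_comp_le {μ : X → E} (hμ : ContDiff ℝ ∞ μ) {Q : Set X}
    (hQ : IsCompact Q) (m : ℕ) :
    ∃ C : ℝ, 0 ≤ C ∧ ∀ φ : E → 𝕜, ContDiff ℝ ∞ φ → ∀ M : ℝ,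
      (∀ k ≤ m, ∀ x, ‖iteratedFDeriv ℝ k φ x‖ ≤ M) →
        ∀ k ≤ m, ∀ z ∈ Q, ‖iteratedFDeriv ℝ k (fun z => φ (μ z)) z‖ ≤ C * M := by
  obtain ⟨D, hD₁, hD⟩ := exists_forall_norm_iteratedFDeriv_le hμ hQ m
  refine ⟨m.factorial * D ^ m, by positivity, fun φ hφ M hM k hk z hz => ?_⟩
  have hM₀ : 0 ≤ M := (norm_nonneg _).trans (hM 0 (Nat.zero_le _) 0)
  refine (norm_iteratedFDeriv_comp_le hφ hμ (mod_cast le_top) z (C := M) (D := D)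
    (fun i hi => hM i (hi.trans hk) _)
    (fun i hi₁ hi => (hD i (hi.trans hk) z hz).trans (le_self_pow₀ hD₁ (by lia)))).trans ?_
  rw [mul_right_comm]
  gcongr

theorem exists_norm_iteratedFDeriv_mul_comp_le {a : X → 𝕜} (ha : ContDiff ℝ ∞ a) {μ : X → E}
    (hμ : ContDiff ℝ ∞ μ) {Q : Set X} (hQ : IsCompact Q) (m : ℕ) :
    ∃ C : ℝ, 0 ≤ C ∧ ∀ φ : E → 𝕜, ContDiff ℝ ∞ φ → ∀ M : ℝ,
      (∀ k ≤ m, ∀ x, ‖iteratedFDeriv ℝ k φ x‖ ≤ M) →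
        ∀ k ≤ m, ∀ z ∈ Q, ‖iteratedFDeriv ℝ k (fun z => a z * φ (μ z)) z‖ ≤ C * M := by
  obtain ⟨A, hA₁, hA⟩ := exists_forall_norm_iteratedFDeriv_le ha hQ m
  obtain ⟨C, hC, hcomp⟩ := exists_norm_iteratedFDeriv_comp_le (𝕜 := 𝕜) hμ hQ m
  refine ⟨2 ^ m * A * C, by positivity, fun φ hφ M hM k hk z hz => ?_⟩
  have hM₀ : 0 ≤ M := (norm_nonneg _).trans (hM 0 (Nat.zero_le _) 0)
  calc ‖iteratedFDeriv ℝ k (fun z => a z * φ (μ z)) z‖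
      ≤ ∑ i ∈ Finset.range (k + 1), (k.choose i : ℝ) * ‖iteratedFDeriv ℝ i a z‖ *
          ‖iteratedFDeriv ℝ (k - i) (fun z => φ (μ z)) z‖ :=
        norm_iteratedFDeriv_mul_le ha (hφ.comp hμ) z (mod_cast le_top)
    _ ≤ ∑ i ∈ Finset.range (k + 1), (k.choose i : ℝ) * A * (C * M) := by
        refine Finset.sum_le_sum fun i hi => ?_
        gcongr
        · exact hA i ((Finset.mem_range_succ_iff.1 hi).trans hk) z hz
        · exact hcomp φ hφ M hM (k - i) ((Nat.sub_le _ _).trans hk) z hz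
    _ = 2 ^ k * A * (C * M) := by
        rw [← Finset.sum_mul, ← Finset.sum_mul]
        congr 2
        exact_mod_cast Nat.sum_range_choose k
    _ ≤ 2 ^ m * A * (C * M) := by
        gcongr
        exact one_le_two
    _ = 2 ^ m * A * C * M := by ring

end Estimates

section MulDilate

variable {𝕜 : Type*} [RCLike 𝕜] {d : ℕ} {O₁ O₂ : Opens (Fin d → ℝ)}

theorem isTestFamily_mul_comp_mul (χ : 𝓓(O₂, 𝕜)) (φ : 𝓓(O₁, 𝕜)) :
    IsTestFamily (tsupportCompacts χ)
      fun z : (Fin d → ℝ) × (Fin d → ℝ) => χ z.1 * φ (z.1 * z.2) where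
  contDiff := (χ.contDiff.comp contDiff_fst).mul (φ.contDiff.comp (contDiff_fst.mul contDiff_snd))
  eq_zero_of_notMem x hx p := by rw [image_eq_zero_of_notMem_tsupport hx, zero_mul]

theorem exists_norm_iteratedFDeriv_mul_comp_mul_le (χ : 𝓓(O₂, 𝕜)) {κ : Set (Fin d → ℝ)}
    (hκ : IsCompact κ) (m : ℕ) : ∃ C : ℝ, 0 ≤ C ∧ ∀ (φ : 𝓓(O₁, 𝕜)) (M : ℝ),
      (∀ k ≤ m, ∀ x, ‖iteratedFDeriv ℝ k φ x‖ ≤ M) → ∀ k ≤ m, ∀ x, ∀ y ∈ κ,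
        ‖iteratedFDeriv ℝ k
          (fun z : (Fin d → ℝ) × (Fin d → ℝ) => χ z.1 * φ (z.1 * z.2)) (x, y)‖ ≤ C * M := by
  obtain ⟨C, hC, h⟩ := exists_norm_iteratedFDeriv_mul_comp_le
    (χ.contDiff.comp contDiff_fst : ContDiff ℝ ∞ fun z : (Fin d → ℝ) × (Fin d → ℝ) => χ z.1)
    (contDiff_fst.mul contDiff_snd) (χ.hasCompactSupport.isCompact.prod hκ) m
  refine ⟨C, hC, fun φ M hM k hk x y hy => ?_⟩
  by_cases hx : x ∈ tsupport χ
  · exact h φ φ.contDiff M hM k hk (x, y) ⟨hx, hy⟩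
  · have hM₀ : 0 ≤ M := (norm_nonneg _).trans (hM 0 (Nat.zero_le _) 0)
    have hsub : tsupport (fun z : (Fin d → ℝ) × (Fin d → ℝ) => χ z.1 * φ (z.1 * z.2)) ⊆
        Prod.fst ⁻¹' tsupport χ :=
      closure_minimal (fun z hz => subset_tsupport χ (left_ne_zero_of_mul hz))
        ((isClosed_tsupport χ).preimage continuous_fst)
    have hzero := image_eq_zero_of_notMem_tsupport
      fun h => hx (hsub (tsupport_iteratedFDeriv_subset (𝕜 := ℝ) k h : (x, y) ∈ _))
    rw [hzero, norm_zero]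
    positivity

/-- The operator `φ ↦ (x ↦ χ x * φ (x * y))` on test functions. -/
def mulDilate (O₁ : Opens (Fin d → ℝ)) (χ : 𝓓(O₂, 𝕜)) (y : Fin d → ℝ) :
    𝓓(O₁, 𝕜) →L[𝕜] 𝓓(O₂, 𝕜) :=
  clmOfBounds
    (fun φ => TestFunction.ofSupportedIn (tsupportCompacts_subset χ)
      ((isTestFamily_mul_comp_mul χ φ).slice y))
    (fun f g => by
      ext x
      exact mul_add (χ x) (f (x * y)) (g (x * y)))
    (fun c f => by
      ext x
      exact mul_left_comm (χ x) c (f (x * y)))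
    (fun K hK => ⟨tsupportCompacts χ, tsupportCompacts_subset χ, fun f x hx =>
      (isTestFamily_mul_comp_mul χ (TestFunction.ofSupportedIn hK f)).eq_zero_of_notMem x hx y,
      fun i => by
        obtain ⟨C, hC, h⟩ :=
          exists_norm_iteratedFDeriv_mul_comp_mul_le χ (isCompact_singleton (x := y)) i
        exact ⟨i, C, hC, fun f M hM x _ =>
          ((isTestFamily_mul_comp_mul χ _).norm_iteratedFDeriv_slice_le y i x).trans
            (h (TestFunction.ofSupportedIn hK f) M hM i le_rfl x y rfl)⟩⟩)

@[simp]
theorem mulDilate_apply (χ : 𝓓(O₂, 𝕜)) (y : Fin d → ℝ) (φ : 𝓓(O₁, 𝕜)) (x : Fin d → ℝ) :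
    mulDilate O₁ χ y φ x = χ x * φ (x * y) := rfl

theorem continuous_mulDilate (χ : 𝓓(O₂, 𝕜)) (φ : 𝓓(O₁, 𝕜)) :
    Continuous fun y => mulDilate O₁ χ y φ :=
  (TestFunction.continuous_ofSupportedIn (tsupportCompacts_subset χ)).comp
    (isTestFamily_mul_comp_mul χ φ).continuous_slice

theorem contDiff_apply_mulDilate (χ : 𝓓(O₂, 𝕜)) (φ : 𝓓(O₁, 𝕜)) (T : 𝓓(O₂, 𝕜) →L_c[𝕜] 𝕜) :
    ContDiff ℝ ∞ fun y => T (mulDilate O₁ χ y φ) :=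
  (isTestFamily_mul_comp_mul χ φ).contDiff_pairing T (tsupportCompacts_subset χ)

theorem exists_norm_iteratedFDeriv_apply_mulDilate_le (χ : 𝓓(O₂, 𝕜)) (T : 𝓓(O₂, 𝕜) →L_c[𝕜] 𝕜)
    {κ : Set (Fin d → ℝ)} (hκ : IsCompact κ) (i : ℕ) :
    ∃ (m : ℕ) (C : ℝ), 0 ≤ C ∧ ∀ (φ : 𝓓(O₁, 𝕜)) (M : ℝ),
      (∀ k ≤ m, ∀ x, ‖iteratedFDeriv ℝ k φ x‖ ≤ M) →
        ∀ y ∈ κ, ‖iteratedFDeriv ℝ i (fun y => T (mulDilate O₁ χ y φ)) y‖ ≤ C * M := by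
  obtain ⟨m, C, hC, h⟩ := IsTestFamily.exists_norm_iteratedFDeriv_pairing_le
    (P := Fin d → ℝ) T (tsupportCompacts_subset χ) i
  obtain ⟨C', hC', h'⟩ := exists_norm_iteratedFDeriv_mul_comp_mul_le χ hκ m
  refine ⟨m, C * C', by positivity, fun φ M hM y hy => ?_⟩
  rw [mul_assoc]
  exact h _ (isTestFamily_mul_comp_mul χ φ) y _ fun k hk x => h' φ M hM k hk x y hy

end MulDilate

section SymbolConvolution

variable {𝕜 : Type*} [RCLike 𝕜] {d : ℕ} {Ω : Opens (Fin d → ℝ)}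

theorem mem_nonzeroCoords_iff_isUnit {x : Fin d → ℝ} : x ∈ nonzeroCoords d ↔ IsUnit x := by
  rw [Pi.isUnit_iff]
  exact forall_congr' fun _ => isUnit_iff_ne_zero.symm

theorem continuousOn_div_nonzeroCoords :
    ContinuousOn (fun p : (Fin d → ℝ) × (Fin d → ℝ) => p.1 / p.2)
      (Set.univ ×ˢ (nonzeroCoords d : Set (Fin d → ℝ))) :=
  continuousOn_pi.2 fun j => ContinuousOn.div (by fun_prop) (by fun_prop) fun _ hp => hp.2 j

theorem isCompact_div {K Q : Set (Fin d → ℝ)} (hK : IsCompact K) (hQ : IsCompact Q)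
    (hQ₀ : Q ⊆ nonzeroCoords d) : IsCompact (K / Q) := by
  rw [← Set.image2_div, ← Set.image_uncurry_prod]
  exact (hK.prod hQ).image_of_continuousOn
    (continuousOn_div_nonzeroCoords.mono (Set.prod_mono (Set.subset_univ _) hQ₀))

theorem mem_div_of_mul_mem {K Q : Set (Fin d → ℝ)} {x y : Fin d → ℝ} (hxy : x * y ∈ K)
    (hxQ : x ∈ Q) (hx : x ∈ nonzeroCoords d) : y ∈ K / Q :=
  ⟨x * y, hxy, x, hxQ, by
    rw [mul_comm]; exact (mem_nonzeroCoords_iff_isUnit.1 hx).mul_div_cancel_right y⟩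

theorem apply_eq_zero_of_disjoint_supportIn (T : ScalarDistribution 𝕜 Ω) {f : 𝓓(Ω, 𝕜)}
    (h : Disjoint (tsupport f) (supportIn T)) : T f = 0 :=
  apply_eq_zero_of_disjoint_dsupport T <| Set.disjoint_left.2 fun _ hx hx' =>
    Set.disjoint_left.1 h hx ⟨hx', f.tsupport_subset hx⟩

theorem apply_congr_of_eventuallyEq (T : ScalarDistribution 𝕜 Ω) {f g : 𝓓(Ω, 𝕜)}
    (h : ∀ᶠ x in 𝓝ˢ (supportIn T), f x = g x) : T f = T g := by
  rw [← sub_eq_zero, ← map_sub]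
  refine apply_eq_zero_of_disjoint_supportIn T (Set.disjoint_left.2 fun x hx hxT => ?_)
  refine notMem_tsupport_iff_eventuallyEq.2 ?_ hx
  filter_upwards [eventually_nhdsSet_iff_forall.1 h x hxT] with z hz
  exact sub_eq_zero.2 hz

theorem tsupport_mulDilate_subset {O : Opens (Fin d → ℝ)} (χ : 𝓓(O, 𝕜)) (y : Fin d → ℝ)
    (φ : 𝓓(Ω, 𝕜)) :
    tsupport (mulDilate Ω χ y φ) ⊆ tsupport χ ∩ {x | x * y ∈ tsupport φ} := by
  refine closure_minimal (fun x hx => ?_)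
    ((isClosed_tsupport _).inter ((isClosed_tsupport _).preimage (by fun_prop)))
  rw [Function.mem_support, mulDilate_apply] at hx
  exact ⟨subset_tsupport _ (left_ne_zero_of_mul hx), subset_tsupport _ (right_ne_zero_of_mul hx)⟩

theorem apply_mulDilate_eq_zero (T : ScalarDistribution 𝕜 (nonzeroCoords d))
    (χ : 𝓓(nonzeroCoords d, 𝕜)) {φ : 𝓓(Ω, 𝕜)} {K : Set (Fin d → ℝ)} (hφ : tsupport φ ⊆ K)
    {y : Fin d → ℝ} (hy : y ∉ K / supportIn T) : T (mulDilate Ω χ y φ) = 0 :=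
  apply_eq_zero_of_disjoint_supportIn T <| Set.disjoint_left.2 fun _ hx hxT =>
    hy (mem_div_of_mul_mem (hφ (tsupport_mulDilate_subset χ y φ hx).2) hxT hxT.2)

namespace IsHadamardSymbol

variable {T : ScalarDistribution 𝕜 (nonzeroCoords d)}

theorem isCompact_div_supportIn (hT : IsHadamardSymbol Ω T) {K : Set (Fin d → ℝ)}
    (hK : IsCompact K) : IsCompact (K / supportIn T) :=
  isCompact_div hK hT.1 Set.inter_subset_right

theorem div_supportIn_subset (hT : IsHadamardSymbol Ω T) {M : Set (Fin d → ℝ)} (hM : M ⊆ Ω) :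
    M / supportIn T ⊆ Ω := by
  rintro _ ⟨z, hz, x, hx, rfl⟩
  simpa only [div_eq_mul_inv, mul_comm] using (hT.2 ⟨x, hx, rfl⟩).2 z (hM hz)

/-- The test function `y ↦ T_x (χ x * φ (x * y))` on `Ω`. It is `y ↦ T_x φ (x * y)` as soon as
`χ = 1` near the support of `T`. -/
def convTestFunction (hT : IsHadamardSymbol Ω T) (χ : 𝓓(nonzeroCoords d, 𝕜)) (φ : 𝓓(Ω, 𝕜)) :
    𝓓(Ω, 𝕜) :=
  have hK : IsCompact (tsupport φ / supportIn T) :=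
    hT.isCompact_div_supportIn φ.hasCompactSupport
  have hsupp : Function.support (fun y => T (mulDilate Ω χ y φ)) ⊆ tsupport φ / supportIn T :=
    fun _ hy => by_contra fun h => hy (apply_mulDilate_eq_zero T χ subset_rfl h)
  { toFun := fun y => T (mulDilate Ω χ y φ)
    contDiff' := contDiff_apply_mulDilate χ φ T
    hasCompactSupport' := HasCompactSupport.of_support_subset_isCompact hK hsupp
    tsupport_subset' :=
      (closure_minimal hsupp hK.isClosed).trans (hT.div_supportIn_subset φ.tsupport_subset) }

theorem convTestFunction_eq_apply_dilate (hΩ : Ω ≤ nonzeroCoords d) (hT : IsHadamardSymbol Ω T)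
    {χ : 𝓓(nonzeroCoords d, 𝕜)} (hχ : ∀ᶠ x in 𝓝ˢ (supportIn T), χ x = 1) (φ : 𝓓(Ω, 𝕜))
    {y : Fin d → ℝ} (hy : y ∈ nonzeroCoords d) :
    hT.convTestFunction χ φ y = T (dilateTestFunction hΩ φ y hy) := by
  refine apply_congr_of_eventuallyEq T (hχ.mono fun x hx => ?_)
  rw [mulDilate_apply, hx, one_mul]
  rfl

/-- The map `φ ↦ (y ↦ T_x (χ x * φ (x * y)))`, as a continuous operator on test functions. -/
def convOperator (hT : IsHadamardSymbol Ω T) (χ : 𝓓(nonzeroCoords d, 𝕜)) :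
    𝓓(Ω, 𝕜) →L[𝕜] 𝓓(Ω, 𝕜) :=
  clmOfBounds (hT.convTestFunction χ)
    (fun f g => by
      ext y
      change T (mulDilate Ω χ y (f + g)) = T (mulDilate Ω χ y f) + T (mulDilate Ω χ y g)
      rw [map_add, map_add])
    (fun c f => by
      ext y
      change T (mulDilate Ω χ y (c • f)) = c • T (mulDilate Ω χ y f)
      rw [map_smul, map_smul])
    (fun K hK => ⟨⟨K / supportIn T, hT.isCompact_div_supportIn K.isCompact⟩,
      hT.div_supportIn_subset hK, fun f _ hy => apply_mulDilate_eq_zero T χ f.tsupport_subset hy,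
      fun i => by
        obtain ⟨m, C, hC, h⟩ := exists_norm_iteratedFDeriv_apply_mulDilate_le (O₁ := Ω) χ T
          (hT.isCompact_div_supportIn K.isCompact) i
        exact ⟨m, C, hC, fun f M hM y hy => h (TestFunction.ofSupportedIn hK f) M hM y hy⟩⟩)

theorem isMulConv_comp_convOperator (hΩ : Ω ≤ nonzeroCoords d) (hT : IsHadamardSymbol Ω T)
    {χ : 𝓓(nonzeroCoords d, 𝕜)} (hχ : ∀ᶠ x in 𝓝ˢ (supportIn T), χ x = 1)
    (S : ScalarDistribution 𝕜 Ω) :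
    IsMulConv hΩ S T ((hT.convOperator χ).precompCompactConvergenceCLM 𝕜 S) := fun φ =>
  ⟨hT.convTestFunction χ φ, fun _ hy => hT.convTestFunction_eq_apply_dilate hΩ hχ φ hy, rfl⟩

theorem exists_cutoff (hT : IsHadamardSymbol Ω T) :
    ∃ χ : 𝓓(nonzeroCoords d, 𝕜), ∀ᶠ x in 𝓝ˢ (supportIn T), χ x = 1 :=
  exists_testFunction_eventuallyEq_one 𝕜 hT.1 Set.inter_subset_right

theorem exists_isMulConv (hΩ : Ω ≤ nonzeroCoords d) (hT : IsHadamardSymbol Ω T)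
    (S : ScalarDistribution 𝕜 Ω) : ∃ R : ScalarDistribution 𝕜 Ω, IsMulConv hΩ S T R := by
  obtain ⟨χ, hχ⟩ := hT.exists_cutoff
  exact ⟨_, hT.isMulConv_comp_convOperator hΩ hχ S⟩

end IsHadamardSymbol

theorem IsMulConv.unique {hΩ : Ω ≤ nonzeroCoords d} {S R R' : ScalarDistribution 𝕜 Ω}
    {T : ScalarDistribution 𝕜 (nonzeroCoords d)} (h : IsMulConv hΩ S T R)
    (h' : IsMulConv hΩ S T R') : R = R' := by
  ext φ
  obtain ⟨ψ, hψ, hR⟩ := h φ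
  obtain ⟨ψ', hψ', hR'⟩ := h' φ
  have hψψ' : ψ = ψ' := by
    ext y
    by_cases hy : y ∈ nonzeroCoords d
    · rw [hψ y hy, hψ' y hy]
    · have hyΩ : y ∉ Ω := fun h => hy (hΩ h)
      rw [testFunction_eq_zero_of_notMem ψ hyΩ, testFunction_eq_zero_of_notMem ψ' hyΩ]
  rw [hR, hR', hψψ']

end SymbolConvolution

section Moments

variable {𝕜 : Type*} [RCLike 𝕜] {d : ℕ} {Ω : Opens (Fin d → ℝ)}

theorem integral_comp_mul_of_mem {x : Fin d → ℝ} (hx : x ∈ nonzeroCoords d)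
    (F : (Fin d → ℝ) → 𝕜) : ∫ y, F (x * y) = (|∏ j, x j|⁻¹ : ℝ) • ∫ z, F z := by
  let e : (Fin d → ℝ) ≃ₜ (Fin d → ℝ) :=
    Homeomorph.piCongrRight fun j => Homeomorph.mulLeft₀ (x j) (hx j)
  have hx₀ : (Matrix.diagonal x).det ≠ 0 := by
    rw [Matrix.det_diagonal]
    exact Finset.prod_ne_zero_iff.2 fun j _ => hx j
  have he : ⇑(Matrix.toLin' (Matrix.diagonal x)) = e := by
    ext y j
    exact Matrix.mulVec_diagonal x y j
  have hmap := Real.map_matrix_volume_pi_eq_smul_volume_pi hx₀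
  rw [he, Matrix.det_diagonal, abs_inv] at hmap
  calc ∫ y, F (x * y) = ∫ z, F z ∂Measure.map e volume :=
        (e.measurableEmbedding.integral_map F).symm
    _ = (|∏ j, x j|⁻¹ : ℝ) • ∫ z, F z := by
        rw [hmap, integral_smul_measure, ENNReal.toReal_ofReal (by positivity)]

/-- The monomial `ξ ^ α`. -/
def monomialFun (α : Fin d → ℕ) (ξ : Fin d → ℝ) : ℝ := ∏ j, ξ j ^ α j

theorem monomialFun_mul (α : Fin d → ℕ) (ξ η : Fin d → ℝ) :
    monomialFun α (ξ * η) = monomialFun α ξ * monomialFun α η := by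
  simp only [monomialFun, Pi.mul_apply, mul_pow, Finset.prod_mul_distrib]

theorem monomialFun_ne_zero (α : Fin d → ℕ) {ξ : Fin d → ℝ} (hξ : ξ ∈ nonzeroCoords d) :
    monomialFun α ξ ≠ 0 := Finset.prod_ne_zero_iff.2 fun j _ => pow_ne_zero _ (hξ j)

theorem contDiff_monomialFun (α : Fin d → ℕ) : ContDiff ℝ ∞ (monomialFun α) :=
  contDiff_prod fun j _ => (contDiff_apply ℝ ℝ j).pow _

theorem monomialDistribution_apply_eq_integral_smul (α : Fin d → ℕ) (φ : 𝓓(Ω, 𝕜)) :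
    monomialDistribution 𝕜 Ω α φ = ∫ ξ, monomialFun α ξ • φ ξ := by
  rw [monomialDistribution_apply]
  exact integral_congr_ae (.of_forall fun ξ =>
    (mul_comm _ _).trans (RCLike.real_smul_eq_coe_mul _ _).symm)

theorem exists_testFunction_integral_ne_zero (𝕜 : Type*) [RCLike 𝕜]
    (hne : (Ω : Set (Fin d → ℝ)).Nonempty) : ∃ φ : 𝓓(Ω, 𝕜), ∫ ξ, φ ξ ≠ 0 := by
  obtain ⟨ξ₀, hξ₀⟩ := hne
  obtain ⟨r, hr, hball⟩ := Metric.nhds_basis_closedBall.mem_iff.1 (Ω.isOpen.mem_nhds hξ₀)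
  let f : ContDiffBump ξ₀ := ⟨r / 2, r, half_pos hr, half_lt_self hr⟩
  have hsupp : tsupport (fun ξ => (f ξ : 𝕜)) ⊆ tsupport f :=
    closure_mono fun ξ hξ => RCLike.ofReal_ne_zero.1 hξ
  refine ⟨⟨fun ξ => (f ξ : 𝕜), (RCLike.ofRealCLM (K := 𝕜)).contDiff.comp f.contDiff,
    f.hasCompactSupport.of_isClosed_subset (isClosed_tsupport _) hsupp,
    hsupp.trans (f.tsupport_eq.trans_subset hball)⟩, ?_⟩
  change ∫ ξ, (f ξ : 𝕜) ≠ 0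
  rw [integral_ofReal]
  exact RCLike.ofReal_ne_zero.2 f.integral_pos.ne'

theorem monomialDistribution_ne_zero (hne : (Ω : Set (Fin d → ℝ)).Nonempty)
    (hΩ : Ω ≤ nonzeroCoords d) (α : Fin d → ℕ) : monomialDistribution 𝕜 Ω α ≠ 0 := by
  obtain ⟨φ, hφ⟩ := exists_testFunction_integral_ne_zero 𝕜 hne
  have hinv : ContDiffOn ℝ ∞ (fun ξ => (monomialFun α ξ)⁻¹) Ω :=
    (contDiff_monomialFun α).contDiffOn.inv fun ξ hξ => monomialFun_ne_zero α (hΩ hξ)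
  have hint : monomialDistribution 𝕜 Ω α (smoothSMul _ hinv φ) = ∫ ξ, φ ξ := by
    rw [monomialDistribution_apply_eq_integral_smul]
    refine integral_congr_ae (.of_forall fun ξ => ?_)
    by_cases hξ : ξ ∈ Ω
    · exact smul_inv_smul₀ (monomialFun_ne_zero α (hΩ hξ)) (φ ξ)
    · simp only [testFunction_eq_zero_of_notMem _ hξ, smul_zero]
  intro hzero
  rw [← hint, hzero] at hφ
  exact hφ rfl

/-- The factor `|x₁ ⋯ x_d|⁻¹ x ^ (-α)` by which the dilation by `x` multiplies the moment of
order `α`. -/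
def momentFactor (α : Fin d → ℕ) (x : Fin d → ℝ) : ℝ := |∏ j, x j|⁻¹ * (monomialFun α x)⁻¹

theorem contDiffOn_momentFactor (α : Fin d → ℕ) :
    ContDiffOn ℝ ∞ (momentFactor α) (nonzeroCoords d) := fun x hx => by
  have hx₀ : ∏ j, x j ≠ 0 := Finset.prod_ne_zero_iff.2 fun j _ => hx j
  have hprod : ContDiff ℝ ∞ fun x : Fin d → ℝ => ∏ j, x j :=
    contDiff_prod fun j _ => contDiff_apply ℝ ℝ j
  have habs : ContDiffAt ℝ ∞ (fun x : Fin d → ℝ => |∏ j, x j|⁻¹) x :=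
    ((contDiffAt_abs hx₀).comp x hprod.contDiffAt).inv (abs_ne_zero.2 hx₀)
  exact (habs.mul ((contDiff_monomialFun α).contDiffAt.inv
    (monomialFun_ne_zero α hx))).contDiffWithinAt

theorem integral_monomialFun_smul_comp_mul (α : Fin d → ℕ) {x : Fin d → ℝ}
    (hx : x ∈ nonzeroCoords d) (φ : 𝓓(Ω, 𝕜)) :
    ∫ y, monomialFun α y • φ (x * y) = momentFactor α x • monomialDistribution 𝕜 Ω α φ := by
  have hmono : ∀ y, monomialFun α y • φ (x * y) =
      (monomialFun α x)⁻¹ • (monomialFun α (x * y) • φ (x * y)) := fun y => by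
    rw [monomialFun_mul, mul_smul, inv_smul_smul₀ (monomialFun_ne_zero α hx)]
  simp_rw [hmono]
  rw [integral_smul, integral_comp_mul_of_mem hx fun z => monomialFun α z • φ z,
    ← monomialDistribution_apply_eq_integral_smul, smul_smul, mul_comm]
  rfl

section Determinacy

variable {F : Type*} [NormedAddCommGroup F] [NormedSpace ℝ F]

theorem exists_mvPolynomial_near {σ : Type*} {Q : Set (σ → ℝ)} (hQ : IsCompact Q)
    {u : (σ → ℝ) → ℝ} (hu : ContinuousOn u Q) {ε : ℝ} (hε : 0 < ε) :
    ∃ p : MvPolynomial σ ℝ, ∀ ξ ∈ Q, |MvPolynomial.eval ξ p - u ξ| < ε := by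
  have : CompactSpace Q := isCompact_iff_compactSpace.1 hQ
  let coord : σ → C(Q, ℝ) := fun j =>
    ⟨fun ξ => ξ.1 j, (continuous_apply j).comp continuous_subtype_val⟩
  let Φ : MvPolynomial σ ℝ →ₐ[ℝ] C(Q, ℝ) := MvPolynomial.aeval coord
  have hΦ : ∀ p (ξ : Q), Φ p ξ = MvPolynomial.eval ξ.1 p := fun p ξ => by
    rw [← MvPolynomial.coe_aeval_eq_eval]
    exact DFunLike.congr_fun (MvPolynomial.algHom_ext
      (f := (ContinuousMap.evalAlgHom ℝ ℝ ξ).comp Φ) (g := MvPolynomial.aeval ξ.1)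
      fun j => by simp [Φ, coord]) p
  have hsep : Φ.range.SeparatesPoints := fun ξ η hne => by
    obtain ⟨j, hj⟩ := Function.ne_iff.1 fun h => hne (Subtype.ext h)
    exact ⟨coord j, ⟨coord j, ⟨MvPolynomial.X j, MvPolynomial.aeval_X _ _⟩, rfl⟩, hj⟩
  obtain ⟨⟨f, p, rfl⟩, hf⟩ :=
    ContinuousMap.exists_mem_subalgebra_near_continuous_of_separatesPoints Φ.range hsep
      (fun ξ : Q => u ξ) (continuousOn_iff_continuous_domRestrict.1 hu) ε hε
  exact ⟨p, fun ξ hξ => hΦ p ⟨ξ, hξ⟩ ▸ hf ⟨ξ, hξ⟩⟩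

theorem integral_eval_smul_eq_zero {g : (Fin d → ℝ) → F} (hg : Continuous g)
    (hgc : HasCompactSupport g) (h : ∀ α : Fin d → ℕ, ∫ ξ, monomialFun α ξ • g ξ = 0)
    (p : MvPolynomial (Fin d) ℝ) : ∫ ξ, MvPolynomial.eval ξ p • g ξ = 0 := by
  simp_rw [MvPolynomial.eval_eq', Finset.sum_smul, mul_smul]
  have hint : ∀ α : Fin d →₀ ℕ, Integrable fun ξ => p.coeff α • monomialFun α ξ • g ξ := fun α =>
    (((contDiff_monomialFun α).continuous.smul hg).integrable_of_hasCompactSupport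
      hgc.smul_left).smul (p.coeff α)
  refine (integral_finsetSum _ fun α _ => hint α).trans (Finset.sum_eq_zero fun α _ => ?_)
  rw [integral_smul, h, smul_zero]

theorem integral_smul_eq_zero_of_forall_moment_eq_zero {g : (Fin d → ℝ) → F} (hg : Continuous g)
    (hgc : HasCompactSupport g) (h : ∀ α : Fin d → ℕ, ∫ ξ, monomialFun α ξ • g ξ = 0)
    {u : (Fin d → ℝ) → ℝ} (hu : Continuous u) : ∫ ξ, u ξ • g ξ = 0 := by
  have hint : ∀ {v : (Fin d → ℝ) → ℝ}, Continuous v → Integrable fun ξ => v ξ • g ξ := fun hv =>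
    (hv.smul hg).integrable_of_hasCompactSupport hgc.smul_left
  have hle : ∀ ε > 0, ‖∫ ξ, u ξ • g ξ‖ ≤ ε * ∫ ξ, ‖g ξ‖ := fun ε hε => by
    obtain ⟨p, hp⟩ := exists_mvPolynomial_near hgc.isCompact hu.continuousOn hε
    have hsub : ∫ ξ, u ξ • g ξ = ∫ ξ, (u ξ - MvPolynomial.eval ξ p) • g ξ := by
      simp_rw [sub_smul]
      rw [integral_sub (hint hu) (hint p.continuous_eval), integral_eval_smul_eq_zero hg hgc h,
        sub_zero]
    rw [hsub, ← integral_const_mul]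
    refine norm_integral_le_of_norm_le
      ((hg.norm.integrable_of_hasCompactSupport hgc.norm).const_mul ε) (.of_forall fun ξ => ?_)
    rw [norm_smul, Real.norm_eq_abs, abs_sub_comm]
    by_cases hξ : ξ ∈ tsupport g
    · exact mul_le_mul_of_nonneg_right (hp ξ hξ).le (norm_nonneg _)
    · simp only [image_eq_zero_of_notMem_tsupport hξ, norm_zero, mul_zero, le_refl]
  have hlim : Tendsto (fun ε : ℝ => ε * ∫ ξ, ‖g ξ‖) (𝓝[>] 0) (𝓝 0) := by
    have hcont : Continuous fun ε : ℝ => ε * ∫ ξ, ‖g ξ‖ := by fun_prop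
    simpa only [zero_mul] using (hcont.tendsto 0).mono_left nhdsWithin_le_nhds
  exact norm_le_zero_iff.1 (ge_of_tendsto hlim (eventually_mem_nhdsWithin.mono hle))

theorem eq_of_forall_moment_eq [CompleteSpace F] {f g : (Fin d → ℝ) → F} (hf : Continuous f)
    (hfc : HasCompactSupport f) (hg : Continuous g) (hgc : HasCompactSupport g)
    (h : ∀ α : Fin d → ℕ, ∫ ξ, monomialFun α ξ • f ξ = ∫ ξ, monomialFun α ξ • g ξ) : f = g := by
  have hmoment : ∀ α : Fin d → ℕ, ∫ ξ, monomialFun α ξ • (f - g) ξ = 0 := fun α => by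
    have hα := (contDiff_monomialFun α).continuous
    simp_rw [Pi.sub_apply, smul_sub]
    have hfi : Integrable fun ξ => monomialFun α ξ • f ξ :=
      (hα.smul hf).integrable_of_hasCompactSupport hfc.smul_left
    have hgi : Integrable fun ξ => monomialFun α ξ • g ξ :=
      (hα.smul hg).integrable_of_hasCompactSupport hgc.smul_left
    rw [integral_sub hfi hgi, h, sub_self]
  have hae : f - g =ᵐ[volume] 0 :=
    ae_eq_zero_of_integral_contDiff_smul_eq_zero (hf.sub hg).locallyIntegrable fun u hu _ =>
      integral_smul_eq_zero_of_forall_moment_eq_zero (hf.sub hg) (hfc.sub hgc) hmoment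
        hu.continuous
  exact sub_eq_zero.1 (((hf.sub hg).ae_eq_iff_eq volume continuous_zero).1 hae)

end Determinacy

end Moments

section Eigenvalues

variable {𝕜 : Type*} [RCLike 𝕜] {d : ℕ} {Ω : Opens (Fin d → ℝ)}

theorem setIntegral_monomialFun_smul_mulDilate (χ : 𝓓(nonzeroCoords d, 𝕜)) (φ : 𝓓(Ω, 𝕜))
    (α : Fin d → ℕ) {κ : Set (Fin d → ℝ)} (hκ : tsupport φ / tsupport χ ⊆ κ) (x : Fin d → ℝ) :
    ∫ y in κ, (monomialFun α y • mulDilate Ω χ y φ) x =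
      monomialDistribution 𝕜 Ω α φ * smoothSMul _ (contDiffOn_momentFactor α) χ x := by
  change ∫ y in κ, monomialFun α y • (χ x * φ (x * y)) =
    monomialDistribution 𝕜 Ω α φ * (momentFactor α x • χ x)
  by_cases hx : x ∈ tsupport χ
  swap
  · simp only [image_eq_zero_of_notMem_tsupport hx, zero_mul, smul_zero, integral_zero, mul_zero]
  have hx₀ : x ∈ nonzeroCoords d := χ.tsupport_subset hx
  rw [setIntegral_eq_integral_of_forall_compl_eq_zero fun y hy => by
    have hxy : x * y ∉ tsupport φ := fun h => hy (hκ (mem_div_of_mul_mem h hx hx₀))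
    rw [image_eq_zero_of_notMem_tsupport hxy, mul_zero, smul_zero]]
  simp_rw [← mul_smul_comm]
  rw [integral_const_mul, integral_monomialFun_smul_comp_mul α hx₀, mul_smul_comm, mul_smul_comm,
    mul_comm]

theorem IsHadamardSymbol.monomialDistribution_convOperator
    {T : ScalarDistribution 𝕜 (nonzeroCoords d)} (hT : IsHadamardSymbol Ω T)
    (χ : 𝓓(nonzeroCoords d, 𝕜)) (α : Fin d → ℕ) (φ : 𝓓(Ω, 𝕜)) :
    monomialDistribution 𝕜 Ω α (hT.convOperator χ φ) =
      T (smoothSMul _ (contDiffOn_momentFactor α) χ) * monomialDistribution 𝕜 Ω α φ := by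
  set ψ := hT.convOperator χ φ
  let κ : Set (Fin d → ℝ) := tsupport φ / tsupport χ ∪ tsupport ψ
  have hκ : IsCompact κ :=
    (isCompact_div φ.hasCompactSupport χ.hasCompactSupport χ.tsupport_subset).union
      ψ.hasCompactSupport
  have hγ : Continuous fun y => monomialFun α y • mulDilate Ω χ y φ :=
    (contDiff_monomialFun α).continuous.smul (continuous_mulDilate χ φ)
  have hfubini := apply_eq_setIntegral_of_forall volume hκ hγ.continuousOn
    (g := monomialDistribution 𝕜 Ω α φ • smoothSMul _ (contDiffOn_momentFactor α) χ)
    (fun x => (setIntegral_monomialFun_smul_mulDilate χ φ α Set.subset_union_left x).symm) T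
  calc monomialDistribution 𝕜 Ω α ψ = ∫ y, monomialFun α y • ψ y :=
        monomialDistribution_apply_eq_integral_smul α ψ
    _ = ∫ y in κ, monomialFun α y • ψ y :=
        (setIntegral_eq_integral_of_forall_compl_eq_zero fun y hy => by
          rw [image_eq_zero_of_notMem_tsupport fun h => hy (Or.inr h), smul_zero]).symm
    _ = ∫ y in κ, T (monomialFun α y • mulDilate Ω χ y φ) :=
        integral_congr_ae (.of_forall fun y => (T.map_smul_of_tower _ _).symm)
    _ = T (smoothSMul _ (contDiffOn_momentFactor α) χ) * monomialDistribution 𝕜 Ω α φ := by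
        rw [← hfubini, map_smul, smul_eq_mul, mul_comm]

theorem IsHadamardSymbol.isHadamardOperator (hne : (Ω : Set (Fin d → ℝ)).Nonempty)
    (hΩ : Ω ≤ nonzeroCoords d) {T : ScalarDistribution 𝕜 (nonzeroCoords d)}
    (hT : IsHadamardSymbol Ω T) {L : ScalarDistribution 𝕜 Ω → ScalarDistribution 𝕜 Ω}
    (hL : ∀ S, IsMulConv hΩ S T (L S)) : IsHadamardOperator L := by
  obtain ⟨χ, hχ⟩ := hT.exists_cutoff
  refine ⟨(hT.convOperator χ).precompCompactConvergenceCLM 𝕜,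
    funext fun S => (hT.isMulConv_comp_convOperator hΩ hχ S).unique (hL S), fun α =>
      ⟨T (smoothSMul _ (contDiffOn_momentFactor α) χ), Module.End.hasEigenvector_iff.2
        ⟨Module.End.mem_eigenspace_iff.2 ?_, monomialDistribution_ne_zero hne hΩ α⟩⟩⟩
  ext φ
  exact hT.monomialDistribution_convOperator χ α φ

end Eigenvalues

section Transpose

variable {𝕜 E F : Type*} [RCLike 𝕜] [NormedAddCommGroup E] [NormedSpace ℝ E]
  [NormedAddCommGroup F] [NormedSpace ℝ F] {Ω : Opens E}

theorem eventually_forall_norm_apply_lt_one {X : Type*} [AddCommGroup X] [Module 𝕜 X]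
    [TopologicalSpace X] {S : ℕ → X →L_c[𝕜] 𝕜} (hS : Tendsto S atTop (𝓝 0)) {C : Set X}
    (hC : IsCompact C) : ∀ᶠ n in atTop, ∀ φ ∈ C, ‖S n φ‖ < 1 := by
  have hbasis := CompactConvergenceCLM.hasBasis_nhds_zero_of_basis (σ := RingHom.id 𝕜)
    (E := X) (F := 𝕜) Metric.nhds_basis_ball
  filter_upwards [hbasis.tendsto_right_iff.1 hS (C, 1) ⟨hC, one_pos⟩] with n hn φ hφ
  exact mem_ball_zero_iff.1 (hn φ hφ)

theorem exists_pos_forall_mul_le (N : ℕ → ℕ → ℝ) :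
    ∃ c B : ℕ → ℝ, (∀ n, 0 < c n) ∧ ∀ i n, c n * |N i n| ≤ B i := by
  have hpos : ∀ n, 0 < 1 + ∑ k ∈ Finset.range (n + 1), |N k n| := fun n => by positivity
  let c : ℕ → ℝ := fun n => (1 + ∑ k ∈ Finset.range (n + 1), |N k n|)⁻¹
  have hterm : ∀ i n, 0 ≤ c n * |N i n| := fun i n =>
    mul_nonneg (inv_nonneg.2 (hpos n).le) (abs_nonneg _)
  refine ⟨c, fun i => 1 + ∑ n ∈ Finset.range i, c n * |N i n|, fun n => inv_pos.2 (hpos n),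
    fun i n => ?_⟩
  rcases lt_or_ge n i with hn | hn
  · have := Finset.single_le_sum (fun n _ => hterm i n) (Finset.mem_range.2 hn)
    linarith
  · have hle : c n * |N i n| ≤ 1 := by
      rw [inv_mul_le_one₀ (hpos n)]
      have := Finset.single_le_sum (f := fun k => |N k n|) (fun _ _ => abs_nonneg _)
        (Finset.mem_range.2 (Nat.lt_succ_of_le hn))
      linarith
    have := Finset.sum_nonneg fun n (_ : n ∈ Finset.range i) => hterm i n
    linarith

variable [FiniteDimensional ℝ E]

theorem exists_smul_mem_isCompact [FiniteDimensional ℝ F] {K : Compacts E} (hK : (K : Set E) ⊆ Ω)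
    (f : ℕ → 𝓓(Ω, F)) (hf : ∀ n, tsupport (f n) ⊆ K) :
    ∃ (C : Set 𝓓(Ω, F)) (c : ℕ → ℝ), IsCompact C ∧ (∀ n, 0 < c n) ∧ ∀ n, c n • f n ∈ C := by
  let g : ℕ → 𝓓_{K}(E, F) := fun n => ContDiffMapSupportedIn.of_support_subset (f n).contDiff
    ((subset_tsupport _).trans (hf n))
  obtain ⟨c, B, hc, hB⟩ := exists_pos_forall_mul_le fun i n =>
    ContDiffMapSupportedIn.seminorm ℝ E F ⊤ K i (g n)
  refine ⟨TestFunction.ofSupportedIn hK '' derivBoundedSet F K B, c,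
    (isCompact_derivBoundedSet K B).image (TestFunction.continuous_ofSupportedIn hK), hc,
    fun n => ⟨c n • g n, fun i x => ?_, rfl⟩⟩
  refine (ContDiffMapSupportedIn.norm_iteratedFDeriv_apply_le_seminorm_top ℝ).trans ?_
  rw [map_smul_eq_mul, Real.norm_of_nonneg (hc n).le]
  exact (mul_le_mul_of_nonneg_left (le_abs_self _) (hc n).le).trans (hB i n)

theorem tendsto_smul_diracDistribution_zero (a : ℕ → 𝕜) {y : ℕ → E}
    (hy : ∀ K : Set E, IsCompact K → K ⊆ Ω → ∀ᶠ n in atTop, y n ∉ K) :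
    Tendsto (fun n => a n • diracDistribution 𝕜 Ω (y n)) atTop (𝓝 0) := by
  have hbasis := CompactConvergenceCLM.hasBasis_nhds_zero_of_basis (σ := RingHom.id 𝕜)
    (E := 𝓓(Ω, 𝕜)) (F := 𝕜) Metric.nhds_basis_ball
  refine hbasis.tendsto_right_iff.2 fun ⟨C, ε⟩ ⟨hC, hε⟩ => ?_
  obtain ⟨K, hK, hCK⟩ := exists_common_support hC
  filter_upwards [hy K K.isCompact hK] with n hn φ hφ
  change a n • φ (y n) ∈ Metric.ball 0 ε
  rw [hCK φ hφ hn, Pi.zero_apply, smul_zero]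
  exact Metric.mem_ball_self hε

theorem exists_isCompact_forall_apply_diracDistribution_eq_zero
    (A : (𝓓(Ω, 𝕜) →L_c[𝕜] 𝕜) →L[𝕜] (𝓓(Ω, 𝕜) →L_c[𝕜] 𝕜)) {K : Compacts E}
    (hK : (K : Set E) ⊆ Ω) :
    ∃ K' : Set E, IsCompact K' ∧ K' ⊆ Ω ∧ ∀ φ : 𝓓(Ω, 𝕜), tsupport φ ⊆ K →
      ∀ y ∉ K', A (diracDistribution 𝕜 Ω y) φ = 0 := by
  obtain ⟨κ, hκΩ, hκ_mono, hκ_exhaust⟩ := exists_compact_exhaustion Ω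
  by_contra! hcon
  choose φ hφ y hy hne using fun n => hcon (κ n) (κ n).isCompact (hκΩ n)
  obtain ⟨C, c, hC, hc, hcC⟩ := exists_smul_mem_isCompact hK φ hφ
  let a : ℕ → 𝕜 := fun n => ((c n : 𝕜) * A (diracDistribution 𝕜 Ω (y n)) (φ n))⁻¹
  have hδ : Tendsto (fun n => a n • diracDistribution 𝕜 Ω (y n)) atTop (𝓝 0) :=
    tendsto_smul_diracDistribution_zero a fun K₁ hK₁ hK₁Ω => by
      obtain ⟨m, hm⟩ := hκ_exhaust K₁ hK₁ hK₁Ω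
      filter_upwards [eventually_ge_atTop m] with n hn hyn
      exact hy n (hκ_mono hn (hm hyn))
  have hAδ : Tendsto (fun n => A (a n • diracDistribution 𝕜 Ω (y n))) atTop (𝓝 0) := by
    rw [← map_zero A]
    exact (A.continuous.tendsto 0).comp hδ
  obtain ⟨n, hn⟩ := (eventually_forall_norm_apply_lt_one hAδ hC).exists
  have hone : A (a n • diracDistribution 𝕜 Ω (y n)) (c n • φ n) = 1 := by
    rw [map_smul A]
    change a n • A (diracDistribution 𝕜 Ω (y n)) (c n • φ n) = 1
    have hreal : c n • φ n = (c n : 𝕜) • φ n := by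
      ext x
      exact RCLike.real_smul_eq_coe_smul (K := 𝕜) (c n) (φ n x)
    rw [hreal, map_smul, smul_eq_mul, smul_eq_mul]
    exact inv_mul_cancel₀ (mul_ne_zero (RCLike.ofReal_ne_zero.2 (hc n).ne') (hne n))
  exact (hn _ (hcC n)).ne (by rw [hone, norm_one])

/-- The map of test functions of which a continuous operator on distributions is the transpose. -/
def transpose (A : (𝓓(Ω, 𝕜) →L_c[𝕜] 𝕜) →L[𝕜] (𝓓(Ω, 𝕜) →L_c[𝕜] 𝕜)) (φ : 𝓓(Ω, 𝕜)) : 𝓓(Ω, 𝕜) :=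
  (exists_testFunction_forall_eq_apply
    { toFun := fun S => A S φ
      map_add' := fun S S' => DFunLike.congr_fun (map_add A S S') φ
      map_smul' := fun c S => DFunLike.congr_fun (map_smul A c S) φ
      cont := (continuous_eval_const φ).comp A.continuous }).choose

theorem apply_transpose (A : (𝓓(Ω, 𝕜) →L_c[𝕜] 𝕜) →L[𝕜] (𝓓(Ω, 𝕜) →L_c[𝕜] 𝕜))
    (S : 𝓓(Ω, 𝕜) →L_c[𝕜] 𝕜) (φ : 𝓓(Ω, 𝕜)) : S (transpose A φ) = A S φ :=
  ((exists_testFunction_forall_eq_apply _).choose_spec S).symm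

end Transpose

section HadamardTranspose

variable {𝕜 : Type*} [RCLike 𝕜] {d : ℕ} {Ω : Opens (Fin d → ℝ)}

theorem transpose_apply_of_forall_eq_comp_mul
    {A : ScalarDistribution 𝕜 Ω →L[𝕜] ScalarDistribution 𝕜 Ω}
    (hA : ∀ α : Fin d → ℕ, ∃ m : 𝕜,
      A (monomialDistribution 𝕜 Ω α) = m • monomialDistribution 𝕜 Ω α)
    {φ φ' : 𝓓(Ω, 𝕜)} {η : Fin d → ℝ} (hη : η ∈ nonzeroCoords d) (h : ∀ z, φ' z = φ (η * z))
    (y : Fin d → ℝ) : transpose A φ' y = transpose A φ (η * y) := by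
  let e : (Fin d → ℝ) ≃ₜ (Fin d → ℝ) :=
    Homeomorph.piCongrRight fun j => Homeomorph.mulLeft₀ (η j) (hη j)
  refine congrFun (eq_of_forall_moment_eq (transpose A φ').continuous
    (transpose A φ').hasCompactSupport ((transpose A φ).continuous.comp e.continuous)
    ((transpose A φ).hasCompactSupport.comp_homeomorph e) fun α => ?_) y
  obtain ⟨m, hm⟩ := hA α
  have hmoment : ∀ u, monomialDistribution 𝕜 Ω α (transpose A u) =
      m * monomialDistribution 𝕜 Ω α u := fun u => by
    rw [apply_transpose, hm]
    rfl
  have hφ' : monomialDistribution 𝕜 Ω α φ' =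
      momentFactor α η • monomialDistribution 𝕜 Ω α φ := by
    rw [← integral_monomialFun_smul_comp_mul α hη, monomialDistribution_apply_eq_integral_smul]
    simp_rw [h]
  calc ∫ ξ, monomialFun α ξ • transpose A φ' ξ
      = m * monomialDistribution 𝕜 Ω α φ' := by
        rw [← monomialDistribution_apply_eq_integral_smul, hmoment]
    _ = momentFactor α η • monomialDistribution 𝕜 Ω α (transpose A φ) := by
        rw [hφ', hmoment, mul_smul_comm]
    _ = ∫ ξ, monomialFun α ξ • transpose A φ (η * ξ) :=
        (integral_monomialFun_smul_comp_mul α hη _).symm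

end HadamardTranspose

section Construction

variable {𝕜 : Type*} [RCLike 𝕜] {d : ℕ} {Ω O : Opens (Fin d → ℝ)}

theorem inv_mem_nonzeroCoords {x : Fin d → ℝ} (hx : x ∈ nonzeroCoords d) :
    x⁻¹ ∈ nonzeroCoords d := fun j => inv_ne_zero (hx j)

/-- The test function `x ↦ φ (x * η)` on any open set `O` which contains its support. -/
def testFunctionCompMul (φ : 𝓓(Ω, 𝕜)) (η : Fin d → ℝ) (hη : η ∈ nonzeroCoords d)
    (h : ∀ x, x * η ∈ tsupport φ → x ∈ O) : 𝓓(O, 𝕜) :=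
  let e : (Fin d → ℝ) ≃ₜ (Fin d → ℝ) :=
    Homeomorph.piCongrRight fun j => Homeomorph.mulRight₀ (η j) (hη j)
  { toFun := fun x => φ (x * η)
    contDiff' := φ.contDiff.comp (contDiff_id.mul contDiff_const)
    hasCompactSupport' := φ.hasCompactSupport.comp_homeomorph e
    tsupport_subset' := (tsupport_comp_eq_preimage φ e).trans_subset h }

theorem tsupport_testFunctionCompMul_subset (φ : 𝓓(Ω, 𝕜)) {η : Fin d → ℝ}
    (hη : η ∈ nonzeroCoords d) (h : ∀ x, x * η ∈ tsupport φ → x ∈ O) :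
    tsupport (testFunctionCompMul φ η hη h) ⊆ {x | x * η ∈ tsupport φ} :=
  closure_minimal (fun x hx => subset_tsupport φ (a := x * η) hx)
    ((isClosed_tsupport _).preimage (by fun_prop))

/-- The functional `f ↦ S_z (χ (z / k) * f (z / k))`. -/
def cutoffDilate (S : ScalarDistribution 𝕜 Ω) (χ : 𝓓(O, 𝕜)) (k : Fin d → ℝ)
    (hk : k ∈ nonzeroCoords d) (h : ∀ z, z * k⁻¹ ∈ tsupport χ → z ∈ Ω) :
    ScalarDistribution 𝕜 (nonzeroCoords d) :=
  (mulDilate (nonzeroCoords d) (testFunctionCompMul χ k⁻¹ (inv_mem_nonzeroCoords hk) h)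
    k⁻¹).precompCompactConvergenceCLM 𝕜 S

theorem cutoffDilate_eq_zero_of_disjoint (S : ScalarDistribution 𝕜 Ω) {χ : 𝓓(O, 𝕜)}
    {k : Fin d → ℝ} (hk : k ∈ nonzeroCoords d) (h : ∀ z, z * k⁻¹ ∈ tsupport χ → z ∈ Ω)
    {f : 𝓓(nonzeroCoords d, 𝕜)} (hf : Disjoint (tsupport f) (tsupport χ)) :
    cutoffDilate S χ k hk h f = 0 := by
  have hzero : mulDilate (nonzeroCoords d)
      (testFunctionCompMul χ k⁻¹ (inv_mem_nonzeroCoords hk) h) k⁻¹ f = 0 := by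
    ext z
    change χ (z * k⁻¹) * f (z * k⁻¹) = 0
    by_cases hz : z * k⁻¹ ∈ tsupport f
    · rw [image_eq_zero_of_notMem_tsupport (Set.disjoint_left.1 hf hz), zero_mul]
    · rw [image_eq_zero_of_notMem_tsupport hz, mul_zero]
  exact (congrArg S hzero).trans (map_zero S)

/-- The identity `N_y (z ↦ φ (z * η)) = N_{y * η} φ`. It says that the operator
`φ ↦ (y ↦ N_y φ)` commutes with dilations. -/
def CommutesWithDilations (N : (Fin d → ℝ) → ScalarDistribution 𝕜 Ω) : Prop :=
  ∀ ⦃φ φ' : 𝓓(Ω, 𝕜)⦄ ⦃η : Fin d → ℝ⦄, η ∈ nonzeroCoords d → (∀ z, φ' z = φ (z * η)) →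
    ∀ y, N y φ' = N (y * η) φ

namespace CommutesWithDilations

variable {N : (Fin d → ℝ) → ScalarDistribution 𝕜 Ω}

theorem cutoffDilate_dilateTestFunction (hN : CommutesWithDilations N) (hΩ : Ω ≤ nonzeroCoords d)
    (χ : 𝓓(O, 𝕜)) {k : Fin d → ℝ} (hk : k ∈ nonzeroCoords d)
    (h : ∀ z, z * k⁻¹ ∈ tsupport χ → z ∈ Ω) (φ : 𝓓(Ω, 𝕜)) {y : Fin d → ℝ}
    (hy : y ∈ nonzeroCoords d) :
    cutoffDilate (N k) χ k hk h (dilateTestFunction hΩ φ y hy) = N y (mulDilate O φ y⁻¹ χ) := by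
  have hy' := mem_nonzeroCoords_iff_isUnit.1 hy
  have hk' := mem_nonzeroCoords_iff_isUnit.1 hk
  have hky : k⁻¹ * y ∈ nonzeroCoords d := mem_nonzeroCoords_iff_isUnit.2 (hk'.inv.mul hy')
  have hdilate := hN (φ := mulDilate O φ y⁻¹ χ) (φ' := mulDilate (nonzeroCoords d)
    (testFunctionCompMul χ k⁻¹ (inv_mem_nonzeroCoords hk) h) k⁻¹
      (dilateTestFunction hΩ φ y hy)) hky (fun z => by
    change χ (z * k⁻¹) * φ (z * k⁻¹ * y) = φ (z * (k⁻¹ * y)) * χ (z * (k⁻¹ * y) * y⁻¹)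
    rw [← mul_assoc, hy'.mul_inv_cancel_right, mul_comm]) k
  rwa [← mul_assoc, hk'.mul_inv_cancel, one_mul] at hdilate

variable {U K : Set (Fin d → ℝ)}

theorem apply_eq_zero_of_tsupport_subset (hN : CommutesWithDilations N) (hUΩ : U ⊆ Ω)
    (hK : ∀ φ : 𝓓(Ω, 𝕜), tsupport φ ⊆ U → ∀ y ∉ K, N y φ = 0) {φ : 𝓓(Ω, 𝕜)} {η : Fin d → ℝ}
    (hη : η ∈ nonzeroCoords d) (hφ : ∀ x, x * η ∈ tsupport φ → x ∈ U) {y : Fin d → ℝ}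
    (hy : y / η ∉ K) : N y φ = 0 := by
  have hdilate := hN hη (fun z => rfl : ∀ z, testFunctionCompMul φ η hη
    (fun x hx => hUΩ (hφ x hx)) z = φ (z * η)) (y / η)
  rw [(mem_nonzeroCoords_iff_isUnit.1 hη).div_mul_cancel] at hdilate
  rw [← hdilate]
  exact hK _ ((tsupport_testFunctionCompMul_subset φ hη _).trans hφ) _ hy

theorem apply_eq_zero_of_forall_div_notMem (hN : CommutesWithDilations N)
    (hΩ : Ω ≤ nonzeroCoords d) (hU : IsOpen U) (hUΩ : U ⊆ Ω) {y₀ : Fin d → ℝ} (hy₀ : y₀ ∈ U)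
    (hK : ∀ φ : 𝓓(Ω, 𝕜), tsupport φ ⊆ U → ∀ y ∉ K, N y φ = 0) {φ : 𝓓(Ω, 𝕜)} {y : Fin d → ℝ}
    (hφ : ∀ z ∈ tsupport φ, z / y ∉ {y₀} / K) : N y φ = 0 := by
  have hunit : ∀ z ∈ Ω, IsUnit z := fun z hz => mem_nonzeroCoords_iff_isUnit.1 (hΩ hz)
  have hy₀' := hunit y₀ (hUΩ hy₀)
  obtain ⟨t, g, hsum, hg⟩ := exists_eq_sum_tsupport_subset φ
    (fun z : tsupport φ => {x | x * (y₀ / z) ∈ U}) (fun z => hU.preimage (by fun_prop))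
    (fun z hz => Set.mem_iUnion.2 ⟨⟨z, hz⟩, by
      rwa [Set.mem_ofPred_eq, mul_comm, (hunit z (φ.tsupport_subset hz)).div_mul_cancel]⟩)
  rw [hsum, map_sum]
  refine Finset.sum_eq_zero fun z _ => ?_
  have hz := hunit z (φ.tsupport_subset z.1.2)
  refine hN.apply_eq_zero_of_tsupport_subset hUΩ hK (η := z / y₀)
    (mem_nonzeroCoords_iff_isUnit.2 (hz.div hy₀')) (fun x hx => ?_) fun hmem => ?_
  · have hcancel : x * (z / y₀) * (y₀ / z) = x := by
      rw [mul_assoc, div_mul_div_comm, mul_comm y₀, (hz.mul hy₀').div_self, mul_one]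
    simpa only [Set.mem_ofPred_eq, hcancel] using (hg z hx).1
  · refine hφ z z.1.2 ⟨y₀, rfl, _, hmem, ?_⟩
    change y₀ / (y / (z / y₀)) = z / y
    rw [div_div_eq_mul_div, hy₀'.mul_div_cancel]

end CommutesWithDilations

theorem isCompact_supportIn_of_forall_disjoint {T : ScalarDistribution 𝕜 Ω} {C : Set (Fin d → ℝ)}
    (hC : IsCompact C) (hCΩ : C ⊆ Ω) (hT : ∀ f : 𝓓(Ω, 𝕜), Disjoint (tsupport f) C → T f = 0) :
    IsCompact (supportIn T) := by
  have hsub : Distribution.dsupport T ⊆ C := fun x hx => by_contra fun hxC =>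
    (Distribution.notMem_dsupport_iff x).2 ⟨Cᶜ,
      fun f hf => hT f (Set.subset_compl_iff_disjoint_right.1 hf),
      hC.isClosed.isOpen_compl, hxC⟩ hx
  rw [supportIn, Set.inter_eq_left.2 (hsub.trans hCΩ)]
  exact hC.of_isClosed_subset Distribution.isClosed_dsupport hsub

theorem image_inv_supportIn_subset_dilationSet (hΩ : Ω ≤ nonzeroCoords d)
    {T : ScalarDistribution 𝕜 (nonzeroCoords d)}
    (hT : ∀ (φ : 𝓓(Ω, 𝕜)) y (hy : y ∈ nonzeroCoords d), y ∉ Ω →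
      T (dilateTestFunction hΩ φ y hy) = 0) :
    (fun x => x⁻¹) '' supportIn T ⊆ dilationSet (Ω : Set (Fin d → ℝ)) := by
  rintro _ ⟨x, ⟨hxT, hx⟩, rfl⟩
  have hx' := mem_nonzeroCoords_iff_isUnit.1 hx
  refine ⟨inv_mem_nonzeroCoords hx, fun z hz => by_contra fun hzΩ => ?_⟩
  have hy' : IsUnit (x⁻¹ * z) := hx'.inv.mul (mem_nonzeroCoords_iff_isUnit.1 (hΩ hz))
  have hy := mem_nonzeroCoords_iff_isUnit.2 hy'
  refine (Distribution.notMem_dsupport_iff x).2 ⟨{v | v * (x⁻¹ * z) ∈ Ω}, fun f hf => ?_,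
    Ω.isOpen.preimage (by fun_prop), ?_⟩ hxT
  · let φ : 𝓓(Ω, 𝕜) := testFunctionCompMul f (x⁻¹ * z)⁻¹
      (inv_mem_nonzeroCoords hy) fun v hv => by
        simpa only [Set.mem_ofPred_eq, hy'.inv_mul_cancel_right] using hf hv
    have hφ : dilateTestFunction hΩ φ (x⁻¹ * z) hy = f := by
      ext v
      exact congrArg f (hy'.mul_inv_cancel_right v)
    rw [← hφ, hT φ _ hy hzΩ]
  · rwa [Set.mem_ofPred_eq, hx'.mul_inv_cancel_left]

theorem exists_cutoffs (𝕜 : Type*) [RCLike 𝕜] (hΩ : Ω ≤ nonzeroCoords d)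
    {U K : Set (Fin d → ℝ)} (hU : IsOpen U) {y₀ : Fin d → ℝ} (hy₀ : y₀ ∈ U)
    (hy₀Ω : y₀ ∈ nonzeroCoords d) (hK : IsCompact K) (hKΩ : K ⊆ Ω) :
    ∃ (W : Opens (Fin d → ℝ)) (t : Finset Ω) (χ : t → 𝓓(W, 𝕜)), W ≤ nonzeroCoords d ∧
      (∀ᶠ x in 𝓝ˢ ({y₀} / K), (∑ k, χ k) x = 1) ∧
      ∀ (k : t), ∀ x ∈ tsupport (χ k), x * k ∈ U := by
  let W : Opens (Fin d → ℝ) := ⟨{x | x ∈ nonzeroCoords d ∧ y₀ / x ∈ Ω},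
    (continuousOn_div_nonzeroCoords.comp (f := fun x => (y₀, x)) (by fun_prop)
      fun _ hx => ⟨trivial, hx⟩).isOpen_inter_preimage (nonzeroCoords d).isOpen Ω.isOpen⟩
  have hQW : {y₀} / K ⊆ (W : Set (Fin d → ℝ)) := by
    rintro _ ⟨_, rfl, x, hx, rfl⟩
    have hy₀' := mem_nonzeroCoords_iff_isUnit.1 hy₀Ω
    have hx' := mem_nonzeroCoords_iff_isUnit.1 (hΩ (hKΩ hx))
    refine ⟨mem_nonzeroCoords_iff_isUnit.2 (hy₀'.div hx'), ?_⟩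
    rw [div_div_eq_mul_div, hy₀'.mul_div_cancel_left]
    exact hKΩ hx
  obtain ⟨χ, hχ⟩ := exists_testFunction_eventuallyEq_one 𝕜
    (isCompact_div isCompact_singleton hK (hKΩ.trans hΩ)) hQW
  obtain ⟨t, g, hsum, hg⟩ := exists_eq_sum_tsupport_subset χ
    (fun k : Ω => {x | x * k ∈ U}) (fun k => hU.preimage (by fun_prop))
    (fun x hx => Set.mem_iUnion.2 ⟨⟨y₀ / x, (χ.tsupport_subset hx).2⟩, by
      rwa [Set.mem_ofPred_eq, mul_comm,
        (mem_nonzeroCoords_iff_isUnit.1 (χ.tsupport_subset hx).1).div_mul_cancel]⟩)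
  exact ⟨W, t, g, fun x hx => hx.1, hsum ▸ hχ, fun k x hx => (hg k hx).1⟩

theorem CommutesWithDilations.exists_isHadamardSymbol
    {N : (Fin d → ℝ) → ScalarDistribution 𝕜 Ω} (hN : CommutesWithDilations N)
    (hΩ : Ω ≤ nonzeroCoords d) (hN₀ : ∀ y ∉ Ω, N y = 0) {U K : Set (Fin d → ℝ)} (hU : IsOpen U)
    (hUΩ : U ⊆ Ω) (hne : U.Nonempty) (hK : IsCompact K) (hKΩ : K ⊆ Ω)
    (hNK : ∀ φ : 𝓓(Ω, 𝕜), tsupport φ ⊆ U → ∀ y ∉ K, N y φ = 0) :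
    ∃ T : ScalarDistribution 𝕜 (nonzeroCoords d), IsHadamardSymbol Ω T ∧
      ∀ (φ : 𝓓(Ω, 𝕜)) y (hy : y ∈ nonzeroCoords d),
        T (dilateTestFunction hΩ φ y hy) = N y φ := by
  obtain ⟨y₀, hy₀⟩ := hne
  obtain ⟨W, t, χ, hW, hχ, hχU⟩ := exists_cutoffs 𝕜 hΩ hU hy₀ (hΩ (hUΩ hy₀)) hK hKΩ
  have hχΩ : ∀ (k : t) z, z * (k : Fin d → ℝ)⁻¹ ∈ tsupport (χ k) → z ∈ Ω := fun k z hz => by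
    have hzU := hχU k _ hz
    rw [(mem_nonzeroCoords_iff_isUnit.1 (hΩ k.1.2)).inv_mul_cancel_right] at hzU
    exact hUΩ hzU
  let T : ScalarDistribution 𝕜 (nonzeroCoords d) := ∑ k : t,
    cutoffDilate (N k) (χ k) k (hΩ k.1.2) (hχΩ k)
  have hTf : ∀ f, T f = ∑ k : t, cutoffDilate (N k) (χ k) k (hΩ k.1.2) (hχΩ k) f :=
    fun f => sum_apply _ _ _
  have hformula : ∀ (φ : 𝓓(Ω, 𝕜)) y (hy : y ∈ nonzeroCoords d),
      T (dilateTestFunction hΩ φ y hy) = N y φ := fun φ y hy => by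
    rw [hTf, Finset.sum_congr rfl fun k _ =>
      hN.cutoffDilate_dilateTestFunction hΩ (χ k) _ (hχΩ k) φ hy, ← map_sum, ← map_sum,
      ← sub_eq_zero, ← map_sub]
    refine hN.apply_eq_zero_of_forall_div_notMem hΩ hU hUΩ hy₀ hNK fun z hz hzQ => ?_
    refine notMem_tsupport_iff_eventuallyEq.2 ?_ hz
    have hcont : Tendsto (fun x => x / y) (𝓝 z) (𝓝 (z / y)) :=
      (Continuous.div_const continuous_id y).tendsto z
    filter_upwards [hcont.eventually (eventually_nhdsSet_iff_forall.1 hχ _ hzQ)] with x hx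
    change φ x * (∑ k, χ k) (x * y⁻¹) - φ x = 0
    rw [← div_eq_mul_inv, hx, mul_one, sub_self]
  refine ⟨T, ⟨?_, image_inv_supportIn_subset_dilationSet hΩ fun φ y hy hyΩ => ?_⟩, hformula⟩
  · refine isCompact_supportIn_of_forall_disjoint
      (isCompact_iUnion fun k => (χ k).hasCompactSupport.isCompact)
      (Set.iUnion_subset fun k => (χ k).tsupport_subset.trans hW) fun f hf => ?_
    rw [hTf]
    exact Finset.sum_eq_zero fun k _ => cutoffDilate_eq_zero_of_disjoint _ _ _
      (Set.disjoint_iUnion_right.1 hf k)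
  · rw [hformula, hN₀ y hyΩ]
    rfl

theorem diracDistribution_eq_zero_of_notMem {y : Fin d → ℝ} (hy : y ∉ Ω) :
    diracDistribution 𝕜 Ω y = 0 := by
  ext φ
  exact testFunction_eq_zero_of_notMem φ hy

theorem exists_isHadamardSymbol_of_isHadamardOperator (hne : (Ω : Set (Fin d → ℝ)).Nonempty)
    (hΩ : Ω ≤ nonzeroCoords d) {L : ScalarDistribution 𝕜 Ω → ScalarDistribution 𝕜 Ω}
    (hL : IsHadamardOperator L) :
    ∃ T : ScalarDistribution 𝕜 (nonzeroCoords d), IsHadamardSymbol Ω T ∧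
      ∀ S, IsMulConv hΩ S T (L S) := by
  obtain ⟨A, rfl, hA⟩ := hL
  obtain ⟨y₀, hy₀⟩ := hne
  obtain ⟨r, hr, hball⟩ := Metric.nhds_basis_closedBall.mem_iff.1 (Ω.isOpen.mem_nhds hy₀)
  obtain ⟨K, hK, hKΩ, hAK⟩ := exists_isCompact_forall_apply_diracDistribution_eq_zero A
    (K := ⟨Metric.closedBall y₀ r, isCompact_closedBall y₀ r⟩) hball
  have hdilate : CommutesWithDilations fun y => A (diracDistribution 𝕜 Ω y) :=
    fun φ φ' η hη h y => by
      rw [← apply_transpose, ← apply_transpose, mul_comm]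
      exact transpose_apply_of_forall_eq_comp_mul
        (fun α => (hA α).imp fun _ hm => hm.apply_eq_smul) hη
        (fun z => (h z).trans (congrArg φ (mul_comm z η))) y
  obtain ⟨T, hT, hTA⟩ := hdilate.exists_isHadamardSymbol hΩ
    (fun y hy => by rw [diracDistribution_eq_zero_of_notMem hy, map_zero]) Metric.isOpen_ball
    (Metric.ball_subset_closedBall.trans hball) (Metric.nonempty_ball.2 hr) hK hKΩ
    fun φ hφ => hAK φ (hφ.trans Metric.ball_subset_closedBall)
  refine ⟨T, hT, fun S φ => ⟨transpose A φ, fun y hy => ?_, (apply_transpose A S φ).symm⟩⟩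
  rw [hTA, ← apply_transpose]
  rfl

end Construction

end

theorem theorem5p3 {𝕜 : Type*} [RCLike 𝕜] {d : ℕ} (Ω : Opens (Fin d → ℝ))
    (hne : (Ω : Set (Fin d → ℝ)).Nonempty) (hΩ : Ω ≤ nonzeroCoords d) :
    (∀ T : ScalarDistribution 𝕜 (nonzeroCoords d), IsHadamardSymbol Ω T →
      ∀ S : ScalarDistribution 𝕜 Ω, ∃ R : ScalarDistribution 𝕜 Ω, IsMulConv hΩ S T R) ∧
    ∀ L : ScalarDistribution 𝕜 Ω → ScalarDistribution 𝕜 Ω,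
      IsHadamardOperator L ↔
        ∃ T : ScalarDistribution 𝕜 (nonzeroCoords d), IsHadamardSymbol Ω T ∧
          ∀ S : ScalarDistribution 𝕜 Ω, IsMulConv hΩ S T (L S) :=
  ⟨fun _ hT S => hT.exists_isMulConv hΩ S, fun _ =>
    ⟨exists_isHadamardSymbol_of_isHadamardOperator hne hΩ,
      fun ⟨_, hT, hL⟩ => hT.isHadamardOperator hne hΩ hL⟩⟩
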